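/- \textbf{Setting.} Fix $\alpha\in(0,1]$, $L\ge 0$, $\delta,\zeta,s_0>0$. For integers $1\le k\le d$, $d\ge 2$, let $\mathcal C(\alpha,L,\delta,k)$ be the class of $f:[0,1]^k\to\mathbb R$ with $|f(u)-f(u')|\le L\|u-u'\|^\alpha$ whenever $\|u-u'\|\le\delta$ (Euclidean norm). Let $(i_1,\dots,i_k)$ be a tuple of distinct elements of $\{1,\dots,d\}$, unknown to the player and fixed over time. In round $t=1,2,\dots$ the player chooses $x_t\in[0,1]^d$ and observes only the reward $r_t(x_t)$, where $r_t(x)=g_t(x_{i_1},\dots,x_{i_k})$. \emph{Stochastic model.} $g_1,g_2,\dots$ are i.i.d. random functions on $[0,1]^k$ whose mean $\bar g(u)=\mathbb E[g_1(u)]$ lies in $\mathcal C(\alpha,L,\delta,k)$, with $\mathbb E[e^{s(g_1(u)-\bar g(u))}]\le e^{\zeta^2s^2/2}$ for all $|s|\le s_0$ and $u\in[0,1]^k$. An optimal strategy $x^*$ is a maximizer of $x\mapsto\bar g(x_{i_1},\dots,x_{i_k})$ on $[0,1]^d$. \emph{Adversarial model.} $g_1,g_2,\dots$ is a fixed sequence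 of functions in $\mathcal C(\alpha,L,\delta,k)$ with values in $[0,1]$. An optimal strategy $x^*$ (for $n$ rounds) is a maximizer of $x\mapsto\sum_{t=1}^n r_t(x)$ on $[0,1]^d$. The regret is $R(n)=\sum_{t=1}^n\mathbb E[r_t(x^*)-r_t(x_t)]$, with the expectation over the random functions (stochastic model) and over the random choices of the player's bandit routine. \emph{Algorithm $\mathrm{CAB}(d,k)$.} First draw a family $\mathcal A$ of $m=\lceil 2ke^k\log d\rceil$ independent random partitions of $\{1,\dots,d\}$ into $k$ (possibly empty) sets $A_1,\dots,A_k$: each coordinate is put independently into one of the $k$ sets, chosen uniformly. For $T=1,2,4,8,\dots$, in the rounds $t=T,\dots,2T-1$, run a freshly started finite-armed bandit algorithm on the arms $$\mathcal P_M=\Big\{\tfrac1M\sum_{j=1}^k a_j\chi_{A_j}:\ a_j\in\{1,\dots,M\},\ (A_1,\dots,A_k)\in\mathcal A\Big\},\qquad M=\Big\lceil\Big(k^{\frac{\alpha-3}2}e^{-\frac k2}(\log d)^{-\frac12}\sqrt{T/\log T}\Big)^{\frac2{2\alpha+k}}\Big\rceil$$ ($M=1$ if $T=1$). In the stochastic model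 this algorithm is UCB-1 for the given sub-Gaussian constants: play each arm once, and then, after $t$ plays, an arm that maximizes $\hat\mu_x+\max\{\zeta\sqrt{8\log t/N_x},\,8\log t/(s_0N_x)\}$, where $N_x$ is the number of plays of $x$ and $\hat\mu_x$ is their average reward; ties are broken by any fixed rule. In the adversarial model it is Exp3 with time horizon $T$: with $K=|\mathcal P_M|$ and $\gamma=\min\{1,\sqrt{K\log K/((e-1)T)}\}$, arm $x$ is played with probability $p_x=(1-\gamma)w_x/\sum_y w_y+\gamma/K$, the weights start at $1$, and after arm $x$ has been played with reward $r$, $w_x$ is multiplied by $\exp(\gamma r/(Kp_x))$. \textbf{Theorem 1.} Put $$B(n)=n^{\frac{\alpha+k}{2\alpha+k}}(\log n)^{\frac{\alpha}{2\alpha+k}}k^{\frac{\alpha(k+6)}{2(2\alpha+k)}}(\log d)^{\frac{\alpha}{2\alpha+k}}.$$ There is a constant $C$, depending only on $\alpha,L,\delta,\zeta,s_0$, and for every $k\ge1$ there are constants $C_k,N_k$, depending only on $k,\alpha,L,\delta,\zeta,s_0$, such that for all $d\ge\max\{2,k\}$ the following holds with probability at least $1-d^{-k}$ over the random family $\mathcal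 A$. For every $k$-tuple of active coordinates, for every instance of the stochastic model and for every instance of the adversarial model, optimal strategies exist, and for all $n\ge2$ and every optimal strategy $x^*$ the regret of $\mathrm{CAB}(d,k)$ (with UCB-1 and with Exp3, respectively) satisfies $$R(n)\le C\,B(n)\quad\text{if } \frac{n}{\log n}\ge N_k\log d,\qquad\text{and}\qquad R(n)\le C_k\,B(n)\quad\text{in any case.}$$ -/

import Mathlib

open MeasureTheory ProbabilityTheory

noncomputable section

namespace ContinuumBandit

/-! ### Strategies and reward functions -/

/-- The cube `[0,1]^k`. -/
abbrev Cube (k : ℕ) : Type := Fin k → unitInterval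

/-- The euclidean distance on `[0,1]^k`. -/
def euclDist {k : ℕ} (u v : Cube k) : ℝ :=
  ‖WithLp.toLp 2 (fun j : Fin k => (u j : ℝ) - (v j : ℝ))‖

/-- The class of locally uniformly Hölder continuous functions with exponent `α`, constant `L`
and restriction `δ`. -/
def IsLocHolder (α L δ : ℝ) {k : ℕ} (f : Cube k → ℝ) : Prop :=
  ∀ u v : Cube k, euclDist u v ≤ δ → |f u - f v| ≤ L * euclDist u v ^ α

/-- The function `(x_1, …, x_d) ↦ g (x_{i_1}, …, x_{i_k})` for a `k`-tuple `i` of distinct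
coordinates. -/
def liftReward {d k : ℕ} (i : Fin k ↪ Fin d) (g : Cube k → ℝ) (x : Cube d) : ℝ :=
  g (fun j => x (i j))

/-! ### Bandit algorithms -/

/-- A (possibly randomized) bandit algorithm with strategies in `X`: given the list, in
chronological order, of the strategies played so far together with the rewards received for them,
it chooses the distribution of the next strategy. -/
abbrev Policy (X : Type*) : Type _ := List (X × ℝ) → PMF X

/-- The law of the history of the first `t` rounds when the reward function of round `s`
is `r s` (`s = 1, 2, …`). -/
def historyLaw {X : Type*} (π : Policy X) (r : ℕ → X → ℝ) : ℕ → PMF (List (X × ℝ))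
  | 0 => PMF.pure []
  | t + 1 => (historyLaw π r t).bind fun h => (π h).map fun x => h ++ [(x, r (t + 1) x)]

/-- The law of the strategy played in round `t ≥ 1`. -/
def playLaw {X : Type*} (π : Policy X) (r : ℕ → X → ℝ) (t : ℕ) : PMF X :=
  (historyLaw π r (t - 1)).bind π

/-- The expectation, over the random choices of the player, of the reward received in
round `t ≥ 1`. -/
def roundReward {X : Type*} (π : Policy X) (r : ℕ → X → ℝ) (t : ℕ) : ℝ :=
  ∑' x, (playLaw π r t x).toReal * r t x

/-! ### UCB-1 -/

open scoped Classical in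
/-- The number of times that `x` has been played. -/
def playCount {X : Type*} (h : List (X × ℝ)) (x : X) : ℕ :=
  (h.filter fun q => q.1 = x).length

open scoped Classical in
/-- The average of the rewards received from `x`. -/
def empMean {X : Type*} (h : List (X × ℝ)) (x : X) : ℝ :=
  ((h.filter fun q => q.1 = x).map Prod.snd).sum / playCount h x

/-- The upper confidence index of UCB-1 after `t = h.length` plays: the empirical mean plus the
deviation that the mean of `playCount h x` independent rewards with sub-Gaussian constants `ζ`, `s₀`
exceeds with probability at most `t ^ (-4)`. For `ζ = 1 / 2` (rewards in `[0,1]`) and `s₀ = ∞` this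
deviation is the familiar `√(2 log t / playCount h x)`. -/
def ucbIndex {X : Type*} (ζ s₀ : ℝ) (h : List (X × ℝ)) (x : X) : ℝ :=
  empMean h x +
    max (ζ * √(8 * Real.log h.length / playCount h x))
      (8 * Real.log h.length / (s₀ * playCount h x))

open scoped Classical in
/-- The strategies that UCB-1 may play next: those not played yet, if there are any, and otherwise
those of maximal index. -/
def ucbCandidates {X : Type*} (ζ s₀ : ℝ) (P : Finset X) (h : List (X × ℝ)) : Finset X :=
  if ∃ x ∈ P, playCount h x = 0 then P.filter fun x => playCount h x = 0
  else P.filter fun x => ∀ y ∈ P, ucbIndex ζ s₀ h y ≤ ucbIndex ζ s₀ h x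

/-- UCB-1 on the finite set `P`, with ties broken by the rule `pick`. It does not use the time
horizon. -/
def ucb1 {X : Type*} (pick : Finset X → X) (ζ s₀ : ℝ) (P : Finset X) (_T : ℕ) : Policy X :=
  fun h => PMF.pure (pick (ucbCandidates ζ s₀ P h))

/-! ### Exp3 -/

/-- The probability with which Exp3 plays `x ∈ P`, when `S` holds the estimated cumulative
rewards: the weights are `exp (γ S / K)`, `K = |P|`. -/
def exp3Prob {X : Type*} (P : Finset X) (γ : ℝ) (S : X → ℝ) (x : X) : ℝ :=
  (1 - γ) * (Real.exp (γ * S x / P.card) / ∑ y ∈ P, Real.exp (γ * S y / P.card)) + γ / P.card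

open scoped Classical in
/-- The estimated cumulative rewards of Exp3: a reward received from `x` is divided by the
probability with which `x` was played and added to the estimate of `x`. -/
def exp3Estimate {X : Type*} (P : Finset X) (γ : ℝ) (h : List (X × ℝ)) : X → ℝ :=
  h.foldl (fun S q y => S y + if y = q.1 then q.2 / exp3Prob P γ S q.1 else 0) (fun _ => 0)

/-- The exploration parameter of Exp3 with `K` arms and time horizon `T`. -/
def exp3Gamma (K T : ℕ) : ℝ :=
  min 1 √(K * Real.log K / ((Real.exp 1 - 1) * T))

theorem exp3Gamma_nonneg (K T : ℕ) : 0 ≤ exp3Gamma K T :=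
  le_min zero_le_one (Real.sqrt_nonneg _)

theorem exp3Gamma_le_one (K T : ℕ) : exp3Gamma K T ≤ 1 := min_le_left _ _

open scoped Classical in
/-- The probabilities of Exp3, extended by zero outside of `P`. -/
def exp3Mass {X : Type*} (P : Finset X) (γ : ℝ) (S : X → ℝ) (x : X) : ENNReal :=
  if x ∈ P then ENNReal.ofReal (exp3Prob P γ S x) else 0

theorem exp3Mass_sum {X : Type*} {P : Finset X} (hP : P.Nonempty) {γ : ℝ} (h0 : 0 ≤ γ)
    (h1 : γ ≤ 1) (S : X → ℝ) : ∑ x ∈ P, exp3Mass P γ S x = 1 := by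
  have hW : 0 < ∑ y ∈ P, Real.exp (γ * S y / P.card) :=
    Finset.sum_pos (fun _ _ => Real.exp_pos _) hP
  have hK : (P.card : ℝ) ≠ 0 := by exact_mod_cast hP.card_ne_zero
  have hnn : ∀ x ∈ P, 0 ≤ exp3Prob P γ S x := fun x _ =>
    add_nonneg (mul_nonneg (by linarith) (div_nonneg (Real.exp_pos _).le hW.le))
      (div_nonneg h0 (Nat.cast_nonneg _))
  have hsum : ∑ x ∈ P, exp3Prob P γ S x = 1 := by
    unfold exp3Prob
    rw [Finset.sum_add_distrib, ← Finset.mul_sum, ← Finset.sum_div, div_self hW.ne',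
      Finset.sum_const, nsmul_eq_mul]
    field_simp
    ring
  rw [Finset.sum_congr rfl (fun x hx => by rw [exp3Mass, if_pos hx]),
    ← ENNReal.ofReal_sum_of_nonneg hnn, hsum, ENNReal.ofReal_one]

theorem exp3Mass_of_notMem {X : Type*} (P : Finset X) (γ : ℝ) (S : X → ℝ) (x : X) (hx : x ∉ P) :
    exp3Mass P γ S x = 0 := by
  rw [exp3Mass, if_neg hx]

open scoped Classical in
/-- Exp3 on the finite set `P` with time horizon `T` (for rewards in `[0,1]`). -/
def exp3 {X : Type*} [Nonempty X] (P : Finset X) (T : ℕ) : Policy X := fun h =>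
  if hP : P.Nonempty then
    PMF.ofFinset
      (exp3Mass P (exp3Gamma P.card T) (exp3Estimate P (exp3Gamma P.card T) h)) P
      (exp3Mass_sum hP (exp3Gamma_nonneg _ _) (exp3Gamma_le_one _ _) _)
      (exp3Mass_of_notMem P _ _)
  else PMF.pure (Classical.arbitrary X)

/-! ### The algorithm CAB(d, k) -/

/-- The number of random partitions. -/
def familySize (d k : ℕ) : ℕ := ⌈2 * k * Real.exp k * Real.log d⌉₊

/-- A family of ordered partitions of the coordinates into `k` (possibly empty) sets: the `a`-th
partition is `A_j = {l | A a l = j}`, `j = 1, …, k`. A uniformly distributed element of this type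
is a family of independent partitions, each obtained by putting every coordinate independently into
one of the `k` sets chosen uniformly at random. -/
abbrev PartitionFamily (d k : ℕ) : Type := Fin (familySize d k) → Fin d → Fin k

/-- The point `(1/M) ∑_j a_j χ_{A_j}` with `a_j ∈ {1, …, M}`, for the partition
`A_j = {l | p l = j}`; here `a_j = b j + 1`. -/
def gridPoint {d k M : ℕ} (p : Fin d → Fin k) (b : Fin k → Fin M) : Cube d := fun l =>
  ⟨(((b (p l) : ℕ) : ℝ) + 1) / M, by
    have hlt : (b (p l) : ℕ) + 1 ≤ M := (b (p l)).isLt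
    have hM : (0 : ℝ) < M := by
      have : 0 < M := by omega
      exact_mod_cast this
    constructor
    · positivity
    · rw [div_le_one hM]
      exact_mod_cast hlt⟩

open scoped Classical in
/-- The finite strategy set built from the family `A` and the integer `M`. -/
def strategySet {d k : ℕ} (A : PartitionFamily d k) (M : ℕ) : Finset (Cube d) :=
  Finset.univ.image fun q : Fin (familySize d k) × (Fin k → Fin M) => gridPoint (A q.1) q.2

/-- The discretization parameter of an epoch of length `T`. The maximum with `1` only matters for
`T = 1`, where the formula is not defined. -/
def gridSize (α : ℝ) (d k T : ℕ) : ℕ :=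
  max 1 ⌈((k : ℝ) ^ ((α - 3) / 2) * Real.exp (-(k : ℝ) / 2) * Real.log d ^ (-(1 / 2) : ℝ) *
    √((T : ℝ) / Real.log T)) ^ (2 / (2 * α + k))⌉₊

/-- CAB(d, k) with the family `A` and the finite-armed bandit algorithm `mab` (which is given its
set of arms and its time horizon). Round `t` belongs to the epoch of the rounds `T, …, 2 T - 1`,
where `T` is the largest power of two with `T ≤ t`; at the beginning of every epoch, `mab` is
started afresh on the strategy set of the epoch. -/
def cab {d k : ℕ} (mab : Finset (Cube d) → ℕ → Policy (Cube d)) (α : ℝ)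
    (A : PartitionFamily d k) : Policy (Cube d) := fun h =>
  let T := 2 ^ Nat.log 2 (h.length + 1)
  mab (strategySet A (gridSize α d k T)) T (h.drop (T - 1))

/-! ### The two models and the regret -/

/-- The mean reward function of the stochastic model. -/
def meanReward {Ω : Type*} [MeasurableSpace Ω] (μ : Measure Ω) {k : ℕ}
    (G : ℕ → Ω → Cube k → ℝ) (u : Cube k) : ℝ :=
  ∫ ω, G 1 ω u ∂μ

/-- The stochastic model: `G 1, G 2, …` are i.i.d. random functions on `[0,1]^k` (with the product
σ-algebra on the space of functions), their mean is locally Hölder continuous, and they are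
sub-Gaussian around it with constants `ζ`, `s₀`. -/
structure IsStochasticModel (α L δ ζ s₀ : ℝ) {Ω : Type*} [MeasurableSpace Ω] (μ : Measure Ω)
    {k : ℕ} (G : ℕ → Ω → Cube k → ℝ) : Prop where
  measurable : ∀ t, Measurable (G (t + 1))
  indep : iIndepFun (fun t => G (t + 1)) μ
  identDistrib : ∀ t, IdentDistrib (G (t + 1)) (G 1) μ μ
  integrable : ∀ u, Integrable (fun ω => G 1 ω u) μ
  holder : IsLocHolder α L δ (meanReward μ G)
  exp_integrable : ∀ s ∈ Set.Icc (-s₀) s₀, ∀ u,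
    Integrable (fun ω => Real.exp (s * (G 1 ω u - meanReward μ G u))) μ
  subGaussian : ∀ s ∈ Set.Icc (-s₀) s₀, ∀ u,
    ∫ ω, Real.exp (s * (G 1 ω u - meanReward μ G u)) ∂μ ≤ Real.exp (1 / 2 * ζ ^ 2 * s ^ 2)

/-- The adversarial model: a fixed sequence of locally Hölder continuous functions with values
in `[0,1]`. -/
structure IsAdversarialModel (α L δ : ℝ) {k : ℕ} (g : ℕ → Cube k → ℝ) : Prop where
  mem_Icc : ∀ t u, g t u ∈ Set.Icc (0 : ℝ) 1
  holder : ∀ t, IsLocHolder α L δ (g t)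

/-- `x` is an optimal strategy of the stochastic model. -/
def IsStochOptimal {Ω : Type*} [MeasurableSpace Ω] (μ : Measure Ω) {d k : ℕ}
    (G : ℕ → Ω → Cube k → ℝ) (i : Fin k ↪ Fin d) (x : Cube d) : Prop :=
  ∀ y, liftReward i (meanReward μ G) y ≤ liftReward i (meanReward μ G) x

/-- `x` is an optimal strategy of the adversarial model for `n` rounds. -/
def IsAdvOptimal {d k : ℕ} (g : ℕ → Cube k → ℝ) (i : Fin k ↪ Fin d) (n : ℕ) (x : Cube d) : Prop :=
  ∀ y, ∑ t ∈ Finset.Icc 1 n, liftReward i (g t) y ≤ ∑ t ∈ Finset.Icc 1 n, liftReward i (g t) x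

/-- The expected regret after `n` rounds against `x` in the stochastic model. -/
def stochRegret {Ω : Type*} [MeasurableSpace Ω] (μ : Measure Ω) {d k : ℕ}
    (G : ℕ → Ω → Cube k → ℝ) (i : Fin k ↪ Fin d) (π : Policy (Cube d)) (x : Cube d) (n : ℕ) : ℝ :=
  ∑ t ∈ Finset.Icc 1 n, ∫ ω,
    (liftReward i (G t ω) x - roundReward π (fun s => liftReward i (G s ω)) t) ∂μ

/-- The expected regret after `n` rounds against `x` in the adversarial model. -/
def advRegret {d k : ℕ} (g : ℕ → Cube k → ℝ) (i : Fin k ↪ Fin d) (π : Policy (Cube d))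
    (x : Cube d) (n : ℕ) : ℝ :=
  ∑ t ∈ Finset.Icc 1 n,
    (liftReward i (g t) x - roundReward π (fun s => liftReward i (g s)) t)

/-- The rate of the regret bound. -/
def regretRate (α : ℝ) (d k n : ℕ) : ℝ :=
  (n : ℝ) ^ ((α + k) / (2 * α + k)) * Real.log n ^ (α / (2 * α + k)) *
    (k : ℝ) ^ (α * (k + 6) / (2 * (2 * α + k))) * Real.log d ^ (α / (2 * α + k))

/-- The number `R` is at most a constant times the rate: with the constant `C` as soon as
`n / log n ≥ N log d`, and with the constant `C'` in any case. -/
def RegretBound (C C' N α : ℝ) (d k n : ℕ) (R : ℝ) : Prop :=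
  (N * Real.log d ≤ n / Real.log n → R ≤ C * regretRate α d k n) ∧
    R ≤ C' * regretRate α d k n

end ContinuumBandit

end

open ContinuumBandit

namespace ContinuumBandit

/-! ### The size of the strategy sets -/

/-- The number of pairs of a partition and a grid function in an epoch of length `T`. -/
noncomputable def armBound (α : ℝ) (d k T : ℕ) : ℝ :=
  (familySize d k : ℝ) * (gridSize α d k T : ℝ) ^ k

/-- The bound for the regret of one epoch of length `T`. -/
noncomputable def epochBound (α L c R : ℝ) (d k T : ℕ) : ℝ :=
  T * (L * (√k / gridSize α d k T) ^ α) +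
    c * (√(armBound α d k T * T * (Real.log T + Real.log (armBound α d k T))) +
      R * armBound α d k T * (1 + Real.log T))

/-- The number whose integer part is, up to rounding, the discretization parameter. -/
noncomputable def gridScale (α : ℝ) (d k T : ℕ) : ℝ :=
  ((k : ℝ) ^ (α - 3) * Real.exp (-k) * (T / (Real.log T * Real.log d))) ^ (1 / (2 * α + k))

theorem log_pos_of_two_le {n : ℕ} (hn : 2 ≤ n) : 0 < Real.log n :=
  Real.log_pos (by exact_mod_cast hn)

theorem half_lt_log_two : (1 : ℝ) / 2 < Real.log 2 := by
  have := Real.log_two_gt_d9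
  linarith

theorem half_le_log {n : ℕ} (hn : 2 ≤ n) : (1 : ℝ) / 2 ≤ Real.log n :=
  half_lt_log_two.le.trans (Real.log_le_log (by norm_num) (by exact_mod_cast hn))

theorem gridSize_eq {α : ℝ} (hα : 0 < α) {d k T : ℕ} (hd : 2 ≤ d) (hT : 2 ≤ T) :
    gridSize α d k T = max 1 ⌈gridScale α d k T⌉₊ := by
  have hld := log_pos_of_two_le hd
  have hlT := log_pos_of_two_le hT
  have hk0 : (0 : ℝ) ≤ k := Nat.cast_nonneg k
  have hden : (0 : ℝ) < 2 * α + k := by positivity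
  unfold gridSize gridScale
  have hy : (0 : ℝ) ≤ T / (Real.log T * Real.log d) := by positivity
  have hbase : (k : ℝ) ^ ((α - 3) / 2) * Real.exp (-(k : ℝ) / 2) *
      Real.log d ^ (-(1 / 2) : ℝ) * √((T : ℝ) / Real.log T) =
      ((k : ℝ) ^ (α - 3) * Real.exp (-k) * (T / (Real.log T * Real.log d))) ^ ((1 : ℝ) / 2) := by
    rw [Real.mul_rpow (by positivity) hy, Real.mul_rpow (by positivity) (Real.exp_pos _).le,
      ← Real.rpow_mul hk0, ← Real.exp_mul, div_mul_eq_div_div,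
      Real.div_rpow (by positivity) hld.le, Real.sqrt_eq_rpow, Real.rpow_neg hld.le]
    rw [show (α - 3) * (1 / 2) = (α - 3) / 2 by ring, show -(k : ℝ) * (1 / 2) = -k / 2 by ring]
    ring
  have hexp : (1 : ℝ) / 2 * (2 / (2 * α + k)) = 1 / (2 * α + k) := by field_simp
  rw [hbase, ← Real.rpow_mul (by positivity), hexp]

theorem familySize_le {d k : ℕ} (hd : 2 ≤ d) (hk : 1 ≤ k) :
    (familySize d k : ℝ) ≤ 4 * k * Real.exp k * Real.log d := by
  have hld := half_le_log hd
  have hk1 : (1 : ℝ) ≤ k := by exact_mod_cast hk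
  have he : (1 : ℝ) ≤ Real.exp k := Real.one_le_exp (by linarith)
  have h1 : (1 : ℝ) ≤ k * Real.exp k := by nlinarith
  have h2 : 1 ≤ 2 * k * Real.exp k * Real.log d := by nlinarith
  have := (Nat.ceil_lt_add_one (by linarith : 0 ≤ 2 * k * Real.exp k * Real.log d)).le
  unfold familySize
  linarith

theorem familySize_pos {d k : ℕ} (hd : 2 ≤ d) (hk : 1 ≤ k) : 0 < familySize d k := by
  have hld := log_pos_of_two_le hd
  have hk1 : (0 : ℝ) < k := by exact_mod_cast hk
  exact Nat.ceil_pos.2 (by positivity)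

theorem gridSize_pos (α : ℝ) (d k T : ℕ) : 0 < gridSize α d k T :=
  lt_of_lt_of_le one_pos (le_max_left _ _)

theorem armBound_pos {α : ℝ} {d k T : ℕ} (hd : 2 ≤ d) (hk : 1 ≤ k) : 0 < armBound α d k T := by
  have := familySize_pos hd hk
  have := gridSize_pos α d k T
  unfold armBound
  positivity

section scale

variable {α : ℝ} {d k T : ℕ}

theorem gridScale_pos (hd : 2 ≤ d) (hk : 1 ≤ k) (hT : 2 ≤ T) : 0 < gridScale α d k T := by
  have hld := log_pos_of_two_le hd
  have hlT := log_pos_of_two_le hT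
  have hk1 : (0 : ℝ) < k := by exact_mod_cast hk
  unfold gridScale
  positivity

theorem gridScale_le_gridSize (hα : 0 < α) (hd : 2 ≤ d) (hT : 2 ≤ T) :
    gridScale α d k T ≤ gridSize α d k T := by
  rw [gridSize_eq hα hd hT]
  exact (Nat.le_ceil _).trans (by exact_mod_cast le_max_right _ _)

theorem gridSize_pow_le (hα : 0 < α) (hd : 2 ≤ d) (hk : 1 ≤ k) (hT : 2 ≤ T)
    (hz : (k : ℝ) ≤ gridScale α d k T) :
    (gridSize α d k T : ℝ) ^ k ≤ Real.exp 1 * gridScale α d k T ^ k := by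
  have hk1 : (1 : ℝ) ≤ k := by exact_mod_cast hk
  set z := gridScale α d k T with hzdef
  have hz0 : 0 < z := by linarith
  have hM : (gridSize α d k T : ℝ) ≤ z * (1 + 1 / z) := by
    rw [gridSize_eq hα hd hT, max_eq_right (Nat.one_le_ceil_iff.2 hz0)]
    have := (Nat.ceil_lt_add_one hz0.le).le
    field_simp
    exact this
  calc (gridSize α d k T : ℝ) ^ k ≤ (z * (1 + 1 / z)) ^ k := by gcongr
    _ = z ^ k * (1 + 1 / z) ^ k := mul_pow _ _ _
    _ ≤ z ^ k * Real.exp (1 / z) ^ k := by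
        gcongr
        linarith [Real.add_one_le_exp (1 / z)]
    _ = z ^ k * Real.exp (k * (1 / z)) := by rw [← Real.exp_nat_mul]
    _ ≤ z ^ k * Real.exp 1 := by
        gcongr
        rw [mul_one_div, div_le_one hz0]
        exact hz
    _ = Real.exp 1 * z ^ k := mul_comm _ _

theorem gridScale_pow_eq (hα : 0 < α) (hd : 2 ≤ d) (hk : 1 ≤ k) (hT : 2 ≤ T) :
    gridScale α d k T ^ k = (k : ℝ) ^ (α - 3) * Real.exp (-k) *
      (T / (Real.log T * Real.log d)) * gridScale α d k T ^ (-(2 * α)) := by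
  have hld := log_pos_of_two_le hd
  have hlT := log_pos_of_two_le hT
  have hk1 : (0 : ℝ) < k := by exact_mod_cast hk
  have hden : (0 : ℝ) < 2 * α + k := by positivity
  unfold gridScale
  set A := (k : ℝ) ^ (α - 3) * Real.exp (-k) * (T / (Real.log T * Real.log d)) with hA
  have hA0 : 0 < A := by positivity
  rw [← Real.rpow_natCast, ← Real.rpow_mul hA0.le, ← Real.rpow_mul hA0.le]
  nth_rw 2 [← Real.rpow_one A]
  rw [← Real.rpow_add hA0]
  congr 1
  field_simp
  ring

theorem armBound_le (hα : 0 < α) (hα1 : α ≤ 1) (hd : 2 ≤ d) (hk : 1 ≤ k) (hT : 2 ≤ T)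
    (hz : (k : ℝ) ≤ gridScale α d k T) :
    armBound α d k T ≤ 4 * Real.exp 1 * (T / Real.log T) * gridScale α d k T ^ (-(2 * α)) := by
  have hld := log_pos_of_two_le hd
  have hlT := log_pos_of_two_le hT
  have hk1 : (1 : ℝ) ≤ k := by exact_mod_cast hk
  have hk0 : (0 : ℝ) < k := by linarith
  have hz0 := gridScale_pos (α := α) hd hk hT
  have hle : (k : ℝ) * (k : ℝ) ^ (α - 3) ≤ 1 := by
    nth_rw 1 [← Real.rpow_one (k : ℝ)]
    rw [← Real.rpow_add hk0]
    exact Real.rpow_le_one_of_one_le_of_nonpos hk1 (by linarith)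
  have hzp : 0 < gridScale α d k T ^ (-(2 * α)) := Real.rpow_pos_of_pos hz0 _
  calc armBound α d k T
      ≤ (4 * k * Real.exp k * Real.log d) * (Real.exp 1 * gridScale α d k T ^ k) :=
        mul_le_mul (familySize_le hd hk) (gridSize_pow_le hα hd hk hT hz) (by positivity)
          (by positivity)
    _ = ((k : ℝ) * (k : ℝ) ^ (α - 3)) *
        (4 * Real.exp 1 * (T / Real.log T) * gridScale α d k T ^ (-(2 * α))) := by
        rw [gridScale_pow_eq hα hd hk hT, Real.exp_neg]
        have := Real.exp_pos (k : ℝ)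
        field_simp
    _ ≤ 1 * (4 * Real.exp 1 * (T / Real.log T) * gridScale α d k T ^ (-(2 * α))) := by
        gcongr
    _ = _ := one_mul _

theorem epochBound_le {L c R : ℝ} (hα : 0 < α) (hα1 : α ≤ 1) (hL : 0 ≤ L) (hc : 0 ≤ c)
    (hR : 1 ≤ R) (hd : 2 ≤ d) (hk : 1 ≤ k) (hT : 2 ≤ T)
    (hz : (k : ℝ) ≤ gridScale α d k T) (hzR : 8 * Real.exp 1 * R ≤ gridScale α d k T ^ α) :
    epochBound α L c R d k T ≤
      (L + c * 20 * Real.exp 1) * (T * ((k : ℝ) ^ (α / 2) * gridScale α d k T ^ (-α))) := by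
  have hlT := half_le_log hT
  have hk1 : (1 : ℝ) ≤ k := by exact_mod_cast hk
  have he : 1 ≤ Real.exp 1 := Real.one_le_exp (by norm_num)
  have hz0 := gridScale_pos (α := α) hd hk hT
  have hK := armBound_le hα hα1 hd hk hT hz
  have hK0 := armBound_pos (α := α) (T := T) hd hk
  have hM := gridScale_le_gridSize (k := k) hα hd hT
  have hkp : 1 ≤ (k : ℝ) ^ (α / 2) := Real.one_le_rpow hk1 (by linarith)
  unfold epochBound
  set z := gridScale α d k T
  set K := armBound α d k T
  have hT0 : (0 : ℝ) < T := by exact_mod_cast (by omega : 0 < T)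
  have hza : 0 < z ^ α := Real.rpow_pos_of_pos hz0 _
  set v := z ^ (-α) with hv
  have hv0 : 0 < v := Real.rpow_pos_of_pos hz0 _
  have hvz : z ^ α * v = 1 := by rw [hv, Real.rpow_neg hz0.le, mul_inv_cancel₀ hza.ne']
  have hv2 : z ^ (-(2 * α)) = v * v := by
    rw [hv, ← Real.rpow_add hz0]; congr 1; ring
  have hRv : 8 * Real.exp 1 * R * v ≤ 1 := by
    calc 8 * Real.exp 1 * R * v ≤ z ^ α * v := by gcongr
      _ = 1 := hvz
  have hev : 8 * Real.exp 1 * v ≤ 1 := by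
    refine le_trans ?_ hRv
    have : 0 ≤ 8 * Real.exp 1 * v := by positivity
    nlinarith
  have hv1 : v ≤ 1 := by nlinarith
  have hKT : K * Real.log T ≤ 4 * Real.exp 1 * (v * v) * T := by
    rw [hv2] at hK
    calc K * Real.log T ≤ (4 * Real.exp 1 * (T / Real.log T) * (v * v)) * Real.log T := by gcongr
      _ = _ := by field_simp
  have hKleT : K ≤ T := by
    have h3 : 4 * Real.exp 1 * (v * v) * T ≤ 1 / 2 * T := by
      gcongr
      nlinarith
    nlinarith
  have hterm1 : T * (L * (√k / gridSize α d k T) ^ α) ≤ L * (T * ((k : ℝ) ^ (α / 2) * v)) := by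
    have : (√(k : ℝ) / gridSize α d k T) ^ α ≤ (k : ℝ) ^ (α / 2) * v := by
      calc (√(k : ℝ) / gridSize α d k T) ^ α ≤ (√(k : ℝ) / z) ^ α := by gcongr
        _ = (k : ℝ) ^ (α / 2) * v := by
          rw [Real.div_rpow (by positivity) hz0.le, Real.sqrt_eq_rpow,
            ← Real.rpow_mul (by linarith), hv, Real.rpow_neg hz0.le, div_eq_mul_inv]
          congr 2
          ring
    calc T * (L * (√k / gridSize α d k T) ^ α) ≤ T * (L * ((k : ℝ) ^ (α / 2) * v)) := by gcongr
      _ = _ := by ring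
  have hterm2 : √(K * T * (Real.log T + Real.log K)) ≤ 8 * Real.exp 1 * (T * v) := by
    rw [Real.sqrt_le_left (by positivity)]
    have hlogK : Real.log K ≤ Real.log T := Real.log_le_log hK0 hKleT
    calc K * T * (Real.log T + Real.log K) ≤ K * T * (Real.log T + Real.log T) := by gcongr
      _ = 2 * T * (K * Real.log T) := by ring
      _ ≤ 2 * T * (4 * Real.exp 1 * (v * v) * T) := by gcongr
      _ = 8 * Real.exp 1 * (T * v) ^ 2 := by ring
      _ ≤ (8 * Real.exp 1 * (T * v)) ^ 2 := by
          rw [mul_pow (8 * Real.exp 1)]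
          gcongr
          nlinarith
  have hterm3 : R * K * (1 + Real.log T) ≤ 12 * Real.exp 1 * (T * v) := by
    calc R * K * (1 + Real.log T) ≤ R * K * (3 * Real.log T) := by gcongr; linarith
      _ = 3 * R * (K * Real.log T) := by ring
      _ ≤ 3 * R * (4 * Real.exp 1 * (v * v) * T) := by gcongr
      _ = 12 * Real.exp 1 * (T * v) * (R * v) := by ring
      _ ≤ 12 * Real.exp 1 * (T * v) * 1 := by
          gcongr
          have : 0 < R * v := by positivity
          nlinarith
      _ = _ := mul_one _
  have hTv : T * v ≤ T * ((k : ℝ) ^ (α / 2) * v) := by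
    gcongr
    exact le_mul_of_one_le_left hv0.le hkp
  calc _ ≤ L * (T * ((k : ℝ) ^ (α / 2) * v)) +
        c * (8 * Real.exp 1 * (T * v) + 12 * Real.exp 1 * (T * v)) := by gcongr
    _ = L * (T * ((k : ℝ) ^ (α / 2) * v)) + c * 20 * Real.exp 1 * (T * v) := by ring
    _ ≤ L * (T * ((k : ℝ) ^ (α / 2) * v)) +
        c * 20 * Real.exp 1 * (T * ((k : ℝ) ^ (α / 2) * v)) := by gcongr
    _ = _ := by ring

theorem mul_gridScale_rpow_le (hα : 0 < α) (hα1 : α ≤ 1) (hd : 2 ≤ d) (hk : 1 ≤ k) (hT : 2 ≤ T) :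
    T * ((k : ℝ) ^ (α / 2) * gridScale α d k T ^ (-α)) ≤ Real.exp 1 * regretRate α d k T := by
  have hld := log_pos_of_two_le hd
  have hlT := log_pos_of_two_le hT
  have hk0 : (0 : ℝ) < k := by exact_mod_cast hk
  have hden : (0 : ℝ) < 2 * α + k := by positivity
  have hT0 : (0 : ℝ) < T := by exact_mod_cast (by omega : 0 < T)
  have key : T * ((k : ℝ) ^ (α / 2) * gridScale α d k T ^ (-α)) =
      Real.exp (k * α / (2 * α + k)) * regretRate α d k T := by
    unfold gridScale regretRate
    rw [← Real.rpow_mul (by positivity), Real.mul_rpow (by positivity) (by positivity),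
      Real.mul_rpow (by positivity) (by positivity), ← Real.rpow_mul hk0.le, ← Real.exp_mul,
      Real.div_rpow (by positivity) (by positivity), Real.mul_rpow hlT.le hld.le]
    have e1 : -(k : ℝ) * (1 / (2 * α + k) * -α) = k * α / (2 * α + k) := by field_simp
    have e2 : (1 / (2 * α + k) * -α) = -(α / (2 * α + k)) := by field_simp
    rw [e1, e2, Real.rpow_neg hT0.le, Real.rpow_neg hlT.le, Real.rpow_neg hld.le]
    have e3 : (T : ℝ) = (T : ℝ) ^ ((α + k) / (2 * α + k)) * (T : ℝ) ^ (α / (2 * α + k)) := by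
      rw [← Real.rpow_add hT0]
      nth_rw 1 [← Real.rpow_one (T : ℝ)]
      congr 1
      field_simp
      ring
    have e4 : (k : ℝ) ^ (α * (k + 6) / (2 * (2 * α + k))) =
        (k : ℝ) ^ (α / 2) * (k : ℝ) ^ ((α - 3) * -(α / (2 * α + k))) := by
      rw [← Real.rpow_add hk0]
      congr 1
      field_simp
      ring
    rw [e4]
    nth_rw 1 [e3]
    have p1 := Real.rpow_pos_of_pos hT0 (α / (2 * α + k))
    have p2 := Real.rpow_pos_of_pos hlT (α / (2 * α + k))
    have p3 := Real.rpow_pos_of_pos hld (α / (2 * α + k))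
    field_simp
  rw [key]
  have hB : 0 ≤ regretRate α d k T := by unfold regretRate; positivity
  gcongr
  rw [div_le_one hden]
  nlinarith

theorem exists_forall_le_gridScale (hα : 0 < α) (hk : 1 ≤ k) (z₀ : ℝ) :
    ∃ N : ℝ, 4 ≤ N ∧ ∀ d T : ℕ, 2 ≤ d → 2 ≤ T → N * Real.log d ≤ T / Real.log T →
      z₀ ≤ gridScale α d k T := by
  have hk0 : (0 : ℝ) < k := by exact_mod_cast hk
  have hden : (0 : ℝ) < 2 * α + k := by positivity
  set a := (k : ℝ) ^ (α - 3) * Real.exp (-k) with ha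
  have ha0 : 0 < a := by positivity
  refine ⟨max 4 ((max z₀ 0) ^ (2 * α + k) / a), le_max_left _ _, fun d T hd hT h => ?_⟩
  have hld := log_pos_of_two_le hd
  have hlT := log_pos_of_two_le hT
  have h1 : (max z₀ 0) ^ (2 * α + k) / a ≤ T / (Real.log T * Real.log d) := by
    rw [div_mul_eq_div_div (T : ℝ), le_div_iff₀ hld]
    exact le_trans (by gcongr; exact le_max_right _ _) h
  have h2 : (max z₀ 0) ^ (2 * α + k) ≤ a * (T / (Real.log T * Real.log d)) := by
    rw [div_le_iff₀ ha0] at h1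
    linarith
  calc z₀ ≤ max z₀ 0 := le_max_left _ _
    _ = ((max z₀ 0) ^ (2 * α + k)) ^ (1 / (2 * α + k)) := by
        rw [← Real.rpow_mul (le_max_right _ _), mul_one_div_cancel hden.ne', Real.rpow_one]
    _ ≤ gridScale α d k T := by
        unfold gridScale
        gcongr

/-- Long epochs have a regret of the order of the rate. -/
theorem exists_epochBound_le (hα : 0 < α) (hα1 : α ≤ 1) {L c : ℝ} (hL : 0 ≤ L) (hc : 0 ≤ c)
    (hk : 1 ≤ k) {R δ : ℝ} (hR : 1 ≤ R) (hδ : 0 < δ) :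
    ∃ N : ℝ, 4 ≤ N ∧ ∀ d T : ℕ, 2 ≤ d → 2 ≤ T → N * Real.log d ≤ T / Real.log T →
      √k / gridSize α d k T ≤ δ ∧ epochBound α L c R d k T ≤
        (L + c * 20 * Real.exp 1) * (Real.exp 1 * regretRate α d k T) := by
  obtain ⟨N, hN, h⟩ := exists_forall_le_gridScale hα hk
    (max k (max (√k / δ) ((8 * Real.exp 1 * R) ^ (1 / α))))
  refine ⟨N, hN, fun d T hd hT hy => ?_⟩
  have hz := h d T hd hT hy
  have hz0 := gridScale_pos (α := α) hd hk hT
  have hM := gridScale_le_gridSize (k := k) hα hd hT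
  simp only [max_le_iff] at hz
  obtain ⟨hzk, hzδ, hzR⟩ := hz
  constructor
  · rw [div_le_iff₀ hδ] at hzδ
    rw [div_le_iff₀ (hz0.trans_le hM)]
    nlinarith
  · have hb : 0 ≤ 8 * Real.exp 1 * R := by positivity
    have hR' : 8 * Real.exp 1 * R ≤ gridScale α d k T ^ α := by
      calc 8 * Real.exp 1 * R = ((8 * Real.exp 1 * R) ^ (1 / α)) ^ α := by
            rw [← Real.rpow_mul hb, one_div_mul_cancel hα.ne', Real.rpow_one]
        _ ≤ _ := by gcongr
    exact (epochBound_le hα hα1 hL hc hR hd hk hT hzk hR').trans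
      (mul_le_mul_of_nonneg_left (mul_gridScale_rpow_le hα hα1 hd hk hT) (by positivity))

end scale

end ContinuumBandit

namespace ContinuumBandit

/-! ### Summation over the epochs -/

theorem sum_Ico_two_pow (f : ℕ → ℝ) (J : ℕ) :
    ∑ t ∈ Finset.Ico 1 (2 ^ J), f t =
      ∑ j ∈ Finset.range J, ∑ s ∈ Finset.range (2 ^ j), f (2 ^ j + s) := by
  induction J with
  | zero => simp
  | succ J ih =>
    rw [Finset.sum_range_succ, ← ih, ← Finset.sum_Ico_consecutive f (n := 2 ^ J)
      Nat.one_le_two_pow (Nat.pow_le_pow_right two_pos J.le_succ),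
      Finset.sum_Ico_eq_sum_range f (2 ^ J)]
    have : 2 ^ (J + 1) - 2 ^ J = 2 ^ J := by rw [pow_succ]; omega
    rw [this]

theorem sum_Icc_le_sum_epochs {f E : ℕ → ℝ} {n : ℕ} (hn : 1 ≤ n)
    (h : ∀ j τ, 2 ^ j ≤ n → τ ≤ 2 ^ j → ∑ s ∈ Finset.range τ, f (2 ^ j + s) ≤ E j) :
    ∑ t ∈ Finset.Icc 1 n, f t ≤ ∑ j ∈ Finset.range (Nat.log 2 n + 1), E j := by
  have hJ : 2 ^ Nat.log 2 n ≤ n := Nat.pow_log_le_self 2 (by omega)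
  have hJ' : n < 2 ^ (Nat.log 2 n + 1) := Nat.lt_pow_succ_log_self one_lt_two n
  have hIcc : Finset.Icc 1 n = Finset.Ico 1 (n + 1) := by ext; simp
  rw [hIcc, ← Finset.sum_Ico_consecutive f (n := 2 ^ Nat.log 2 n) Nat.one_le_two_pow (by omega),
    sum_Ico_two_pow, Finset.sum_range_succ, Finset.sum_Ico_eq_sum_range]
  refine add_le_add (Finset.sum_le_sum fun j hj => ?_) (h _ _ hJ (by rw [pow_succ] at hJ'; omega))
  refine h _ _ ?_ le_rfl
  exact (Nat.pow_le_pow_right two_pos (Finset.mem_range.1 hj).le).trans hJ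

theorem sum_sqrt_two_pow_le (J : ℕ) :
    ∑ j ∈ Finset.range (J + 1), √((2 : ℝ) ^ j) ≤ 4 * √((2 : ℝ) ^ J) := by
  have h2 : (4 : ℝ) / 3 ≤ √2 := Real.le_sqrt_of_sq_le (by norm_num)
  induction J with
  | zero => simp
  | succ J ih =>
    rw [Finset.sum_range_succ]
    have : √((2 : ℝ) ^ (J + 1)) = √((2 : ℝ) ^ J) * √2 := by
      rw [pow_succ, Real.sqrt_mul (by positivity)]
    rw [this]
    nlinarith [Real.sqrt_nonneg ((2 : ℝ) ^ J)]

theorem sum_sqrt_epochs_le {n : ℕ} (hn : 1 ≤ n) :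
    ∑ j ∈ Finset.range (Nat.log 2 n + 1), √((2 : ℝ) ^ j / n) ≤ 4 := by
  have hJ : ((2 : ℝ) ^ Nat.log 2 n) ≤ n := by
    exact_mod_cast Nat.pow_log_le_self 2 (by omega)
  have hn0 : (0 : ℝ) < √(n : ℝ) := Real.sqrt_pos.2 (by exact_mod_cast hn)
  simp_rw [Real.sqrt_div (pow_nonneg zero_le_two _)]
  rw [← Finset.sum_div, div_le_iff₀ hn0]
  exact (sum_sqrt_two_pow_le _).trans (by gcongr)

section rate

variable {α : ℝ} {d k : ℕ}

theorem regretRate_nonneg (α : ℝ) (d k n : ℕ) : 0 ≤ regretRate α d k n := by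
  have := Real.log_natCast_nonneg n
  have := Real.log_natCast_nonneg d
  unfold regretRate
  positivity

theorem regretRate_le_of_le (hα : 0 < α) {T n : ℕ} (hT : 1 ≤ T) (hTn : T ≤ n) :
    regretRate α d k T ≤ regretRate α d k n * √((T : ℝ) / n) := by
  have hk0 : (0 : ℝ) ≤ k := Nat.cast_nonneg k
  have hden : (0 : ℝ) < 2 * α + k := by positivity
  have hT0 : (0 : ℝ) < T := by exact_mod_cast hT
  have hTn' : (T : ℝ) ≤ n := by exact_mod_cast hTn
  have hn0 : (0 : ℝ) < n := by linarith
  have hlT := Real.log_natCast_nonneg T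
  have hld := Real.log_natCast_nonneg d
  have hlog : Real.log T ≤ Real.log n := Real.log_le_log hT0 hTn'
  have hpow : (T : ℝ) ^ ((α + k) / (2 * α + k)) ≤
      (n : ℝ) ^ ((α + k) / (2 * α + k)) * √((T : ℝ) / n) := by
    have h1 : ((T : ℝ) / n) ^ ((α + k) / (2 * α + k)) ≤ √((T : ℝ) / n) := by
      rw [Real.sqrt_eq_rpow]
      refine Real.rpow_le_rpow_of_exponent_ge (by positivity) ((div_le_one hn0).2 hTn') ?_
      rw [div_le_div_iff₀ two_pos hden]
      nlinarith
    have h2 := Real.div_rpow hT0.le hn0.le ((α + k) / (2 * α + k))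
    rw [h2, div_le_iff₀ (by positivity)] at h1
    linarith
  unfold regretRate
  calc _ ≤ ((n : ℝ) ^ ((α + k) / (2 * α + k)) * √((T : ℝ) / n)) *
        Real.log n ^ (α / (2 * α + k)) *
        (k : ℝ) ^ (α * (k + 6) / (2 * (2 * α + k))) * Real.log d ^ (α / (2 * α + k)) := by gcongr
    _ = _ := by ring

theorem mul_rpow_le_regretRate (hα : 0 < α) (hk : 1 ≤ k) {n : ℕ} (hn : 1 ≤ n) :
    n * (Real.log n * Real.log d / n) ^ (α / (2 * α + k)) ≤ regretRate α d k n := by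
  have hk1 : (1 : ℝ) ≤ k := by exact_mod_cast hk
  have hden : (0 : ℝ) < 2 * α + k := by positivity
  have hn0 : (0 : ℝ) < n := by exact_mod_cast hn
  have hln := Real.log_natCast_nonneg n
  have hld := Real.log_natCast_nonneg d
  have hkp : 1 ≤ (k : ℝ) ^ (α * (k + 6) / (2 * (2 * α + k))) :=
    Real.one_le_rpow hk1 (by positivity)
  have e3 : (n : ℝ) = (n : ℝ) ^ ((α + k) / (2 * α + k)) * (n : ℝ) ^ (α / (2 * α + k)) := by
    rw [← Real.rpow_add hn0]
    nth_rw 1 [← Real.rpow_one (n : ℝ)]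
    congr 1
    field_simp
    ring
  have hp := Real.rpow_pos_of_pos hn0 (α / (2 * α + k))
  rw [Real.div_rpow (by positivity) hn0.le, Real.mul_rpow hln hld]
  unfold regretRate
  calc (n : ℝ) * (Real.log n ^ (α / (2 * α + k)) * Real.log d ^ (α / (2 * α + k)) /
          n ^ (α / (2 * α + k))) =
        n ^ ((α + k) / (2 * α + k)) * Real.log n ^ (α / (2 * α + k)) * 1 *
          Real.log d ^ (α / (2 * α + k)) := by
        nth_rw 1 [e3]
        field_simp
    _ ≤ _ := by gcongr

/-- A per-round bound together with a bound for long epochs yields the rate. -/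
theorem exists_regretBound_of_epochBound (hα : 0 < α) (hα1 : α ≤ 1) {L c : ℝ} (hL : 0 ≤ L)
    (hc : 0 ≤ c) :
    ∃ C : ℝ, 0 < C ∧ ∀ k : ℕ, 1 ≤ k → ∀ R δ : ℝ, 1 ≤ R → 0 < δ →
      ∃ C' N : ℝ, 0 < C' ∧ 0 < N ∧ ∀ d : ℕ, 2 ≤ d → ∀ reg : ℕ → ℝ,
        (∀ t, 1 ≤ t → reg t ≤ R) →
        (∀ j τ, τ ≤ 2 ^ j → √k / gridSize α d k (2 ^ j) ≤ δ →
          ∑ s ∈ Finset.range τ, reg (2 ^ j + s) ≤ epochBound α L c R d k (2 ^ j)) →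
        ∀ n : ℕ, 2 ≤ n → RegretBound C C' N α d k n (∑ t ∈ Finset.Icc 1 n, reg t) := by
  set C₁ := (L + c * 20 * Real.exp 1) * Real.exp 1 with hC₁
  have hC₁0 : 0 ≤ C₁ := by positivity
  refine ⟨4 * (C₁ + 1), by positivity, fun k hk R δ hR hδ => ?_⟩
  obtain ⟨N₀, hN₀, hlong⟩ := exists_epochBound_le hα hα1 hL hc hk hR hδ
  set N := R ^ 6 * N₀ ^ 3 with hN
  have hN1 : 1 ≤ N := by
    have h1 : 1 ≤ R ^ 6 := one_le_pow₀ hR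
    have h2 : 1 ≤ N₀ ^ 3 := one_le_pow₀ (by linarith)
    nlinarith
  refine ⟨4 * (C₁ + 1) + R * N, N, by positivity, by positivity, ?_⟩
  intro d hd reg htriv hepoch n hn
  have hld := half_le_log hd
  have hln := half_le_log hn
  have hk0 : (0 : ℝ) < k := by exact_mod_cast hk
  have hden : (0 : ℝ) < 2 * α + k := by positivity
  have hn0 : (0 : ℝ) < n := by exact_mod_cast (by omega : 0 < n)
  set D := N₀ * Real.log d * Real.log n with hD
  have hD1 : 1 ≤ D := by nlinarith [mul_le_mul hld hln (by norm_num) (by linarith)]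
  set B := regretRate α d k n with hB
  have hB0 : 0 ≤ B := regretRate_nonneg _ _ _ _
  set w := Real.log n * Real.log d / n with hw
  have hw0 : 0 < w := by positivity
  have hBw : n * w ^ (α / (2 * α + k)) ≤ B := mul_rpow_le_regretRate hα hk (by omega)
  have hmain : ∑ t ∈ Finset.Icc 1 n, reg t ≤ 4 * (C₁ * B + R * √(D * n)) := by
    have hE : ∀ j τ, 2 ^ j ≤ n → τ ≤ 2 ^ j → ∑ s ∈ Finset.range τ, reg (2 ^ j + s) ≤
        (C₁ * B + R * √(D * n)) * √((2 : ℝ) ^ j / n) := by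
      intro j τ hj hτ
      have hjn : ((2 : ℝ) ^ j) ≤ n := by exact_mod_cast hj
      by_cases hcase : 1 ≤ j ∧ N₀ * Real.log d ≤ ((2 ^ j : ℕ) : ℝ) / Real.log ((2 ^ j : ℕ) : ℝ)
      · have hT2 : 2 ≤ 2 ^ j := by
          calc 2 = 2 ^ 1 := rfl
            _ ≤ 2 ^ j := Nat.pow_le_pow_right two_pos hcase.1
        obtain ⟨h1, h2⟩ := hlong d (2 ^ j) hd hT2 hcase.2
        refine (hepoch j τ hτ h1).trans (h2.trans ?_)
        have h3 := regretRate_le_of_le (α := α) (d := d) (k := k) hα (by omega : 1 ≤ 2 ^ j) hj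
        push_cast at h3
        calc _ = C₁ * regretRate α d k (2 ^ j) := by rw [hC₁]; ring
          _ ≤ C₁ * (B * √((2 : ℝ) ^ j / n)) := by gcongr
          _ ≤ _ := by
            have : 0 ≤ R * √(D * n) * √((2 : ℝ) ^ j / n) := by positivity
            linarith
      · have hTD : (2 : ℝ) ^ j ≤ D := by
          rcases Nat.eq_zero_or_pos j with rfl | hj0
          · simpa using hD1
          · have hlt := not_le.1 fun h => hcase ⟨hj0, h⟩
            have hT2 : 2 ≤ 2 ^ j := by
              calc 2 = 2 ^ 1 := rfl
                _ ≤ 2 ^ j := Nat.pow_le_pow_right two_pos hj0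
            have hlT := log_pos_of_two_le hT2
            rw [div_lt_iff₀ hlT] at hlt
            have hlog : Real.log ((2 ^ j : ℕ) : ℝ) ≤ Real.log n :=
              Real.log_le_log (by positivity) (by exact_mod_cast hj)
            push_cast at hlt hlog
            calc (2 : ℝ) ^ j ≤ N₀ * Real.log d * Real.log (2 ^ j) := hlt.le
              _ ≤ D := by rw [hD]; gcongr
        have hτ' : (τ : ℝ) ≤ (2 : ℝ) ^ j := by exact_mod_cast hτ
        calc ∑ s ∈ Finset.range τ, reg (2 ^ j + s) ≤ ∑ s ∈ Finset.range τ, R :=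
              Finset.sum_le_sum fun s _ => htriv _ (le_add_right Nat.one_le_two_pow)
          _ = R * τ := by rw [Finset.sum_const, Finset.card_range, nsmul_eq_mul, mul_comm]
          _ ≤ R * (√((2 : ℝ) ^ j) * √((2 : ℝ) ^ j)) := by
              rw [Real.mul_self_sqrt (by positivity)]; gcongr
          _ ≤ R * (√D * √((2 : ℝ) ^ j)) := by gcongr
          _ = R * √(D * n) * √((2 : ℝ) ^ j / n) := by
              rw [Real.sqrt_mul (by positivity : 0 ≤ D) n, Real.sqrt_div (by positivity)]
              have := Real.sqrt_pos.2 hn0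
              field_simp
          _ ≤ _ := by
              have : 0 ≤ C₁ * B * √((2 : ℝ) ^ j / n) := by positivity
              linarith
    refine (sum_Icc_le_sum_epochs (by omega) hE).trans ?_
    rw [← Finset.mul_sum, mul_comm]
    exact mul_le_mul_of_nonneg_right (sum_sqrt_epochs_le (by omega)) (by positivity)
  have hfirst : N * Real.log d ≤ n / Real.log n →
      ∑ t ∈ Finset.Icc 1 n, reg t ≤ 4 * (C₁ + 1) * B := by
    intro hy
    have hwN : w * N ≤ 1 := by
      rw [le_div_iff₀ (by linarith)] at hy
      rw [hw, div_mul_eq_mul_div, div_le_one hn0]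
      linarith
    have hw1 : w ≤ 1 := by nlinarith
    have hsmall : R * √(D * n) ≤ B := by
      refine le_trans ?_ hBw
      have hDn : D * n = N₀ * w * (n : ℝ) ^ 2 := by rw [hD, hw]; field_simp
      rw [hDn, Real.sqrt_mul (by positivity), Real.sqrt_sq hn0.le]
      have hthird : w ^ ((1 : ℝ) / 3) ≤ w ^ (α / (2 * α + k)) := by
        refine Real.rpow_le_rpow_of_exponent_ge hw0 hw1 ?_
        rw [div_le_div_iff₀ hden three_pos]
        have : (1 : ℝ) ≤ k := by exact_mod_cast hk
        linarith
      have hsix : R * √(N₀ * w) ≤ w ^ ((1 : ℝ) / 3) := by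
        refine le_of_pow_le_pow_left₀ (n := 6) (by norm_num) (by positivity) ?_
        have e1 : (w ^ ((1 : ℝ) / 3)) ^ 6 = w ^ 2 := by
          rw [← Real.rpow_natCast, ← Real.rpow_mul hw0.le, ← Real.rpow_natCast]
          norm_num
        have e2 : (R * √(N₀ * w)) ^ 6 = w * N * w ^ 2 := by
          rw [mul_pow, show √(N₀ * w) ^ 6 = (√(N₀ * w) ^ 2) ^ 3 by ring,
            Real.sq_sqrt (by positivity), hN]
          ring
        rw [e1, e2]
        have : 0 < w ^ 2 := by positivity
        nlinarith
      calc R * (√(N₀ * w) * n) = n * (R * √(N₀ * w)) := by ring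
        _ ≤ _ := by gcongr; exact hsix.trans hthird
    calc _ ≤ _ := hmain
      _ ≤ 4 * (C₁ * B + B) := by gcongr
      _ = _ := by ring
  refine ⟨hfirst, ?_⟩
  by_cases hy : N * Real.log d ≤ n / Real.log n
  · refine (hfirst hy).trans ?_
    have : 0 ≤ R * N * B := by positivity
    linarith
  · have hwN : N⁻¹ ≤ w := by
      have hlt := not_le.1 hy
      rw [div_lt_iff₀ (by linarith)] at hlt
      rw [inv_eq_one_div, hw, div_le_div_iff₀ (by positivity) hn0]
      linarith
    have hNB : (n : ℝ) ≤ N * B := by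
      have h1 : N⁻¹ ≤ w ^ (α / (2 * α + k)) := by
        calc N⁻¹ = N⁻¹ ^ (1 : ℝ) := (Real.rpow_one _).symm
          _ ≤ N⁻¹ ^ (α / (2 * α + k)) := by
            refine Real.rpow_le_rpow_of_exponent_ge (by positivity) (inv_le_one_of_one_le₀ hN1) ?_
            rw [div_le_one hden]
            linarith
          _ ≤ _ := by gcongr
      calc (n : ℝ) = N * (n * N⁻¹) := by field_simp
        _ ≤ N * (n * w ^ (α / (2 * α + k))) := by gcongr
        _ ≤ N * B := by gcongr
    calc ∑ t ∈ Finset.Icc 1 n, reg t ≤ ∑ t ∈ Finset.Icc 1 n, R :=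
          Finset.sum_le_sum fun t ht => htriv t (Finset.mem_Icc.1 ht).1
      _ = R * n := by simp [mul_comm]
      _ ≤ R * (N * B) := by gcongr
      _ ≤ _ := by
        have : 0 ≤ 4 * (C₁ + 1) * B := by positivity
        linarith

end rate

end ContinuumBandit

namespace ContinuumBandit

/-! ### Random partitions -/

open scoped Classical in
theorem le_card_injective_comp {d k : ℕ} (i : Fin k ↪ Fin d) :
    k.factorial * k ^ (d - k) ≤
      (Finset.univ.filter fun p : Fin d → Fin k => Function.Injective fun j => p (i j)).card := by
  have hcard : Fintype.card (Equiv.Perm (Fin k) × ({l : Fin d // l ∉ Set.range i} → Fin k)) =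
      k.factorial * k ^ (d - k) := by
    rw [Fintype.card_prod, Fintype.card_perm, Fintype.card_fun, Fintype.card_fin,
      Fintype.card_subtype_compl, Fintype.card_fin]
    congr 3
    have : Fintype.card (Set.range i) = k := by
      rw [Set.card_range_of_injective i.injective, Fintype.card_fin]
    convert this using 1
  rw [← hcard, ← Finset.card_univ]
  let F : Equiv.Perm (Fin k) × ({l : Fin d // l ∉ Set.range i} → Fin k) → Fin d → Fin k :=
    fun q l => if h : l ∈ Set.range i then q.1 h.choose else q.2 ⟨l, h⟩
  have hF : ∀ q j, F q (i j) = q.1 j := fun q j => by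
    have h : i j ∈ Set.range i := ⟨j, rfl⟩
    simp only [F, dif_pos h]
    rw [i.injective h.choose_spec]
  refine Finset.card_le_card_of_injOn F (fun q _ => ?_) fun q _ q' _ h => ?_
  · simp only [Finset.coe_filter, Finset.mem_univ, true_and, Set.mem_ofPred_eq, hF]
    exact q.1.injective
  · refine Prod.ext (Equiv.ext fun j => ?_) (funext fun l => ?_)
    · rw [← hF, ← hF, h]
    · have := congrFun h l.1
      simpa only [F, dif_neg l.2] using this

open scoped Classical in
theorem card_not_injective_comp_le {d k : ℕ} (hk : 1 ≤ k) (i : Fin k ↪ Fin d) :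
    ((Finset.univ.filter fun p : Fin d → Fin k =>
      ¬ Function.Injective fun j => p (i j)).card : ℝ) ≤ (1 - Real.exp (-k)) * k ^ d := by
  have hkd : k ≤ d := by simpa using Fintype.card_le_of_embedding i
  have hsum := Finset.card_filter_add_card_filter_not (s := (Finset.univ : Finset (Fin d → Fin k)))
    (fun p => Function.Injective fun j => p (i j))
  rw [Finset.card_univ, Fintype.card_fun, Fintype.card_fin, Fintype.card_fin] at hsum
  have hle := le_card_injective_comp i
  have hk0 : (0 : ℝ) < k := by exact_mod_cast hk
  have hfac : Real.exp (-k) * (k : ℝ) ^ k ≤ k.factorial := by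
    have := Real.pow_div_factorial_le_exp (k : ℝ) hk0.le k
    rw [div_le_iff₀ (by positivity)] at this
    rw [Real.exp_neg, inv_mul_le_iff₀ (Real.exp_pos _)]
    exact this
  have hgood : Real.exp (-k) * (k : ℝ) ^ d ≤
      ((Finset.univ.filter fun p : Fin d → Fin k => Function.Injective fun j => p (i j)).card : ℝ) := by
    calc Real.exp (-k) * (k : ℝ) ^ d = Real.exp (-k) * (k : ℝ) ^ k * (k : ℝ) ^ (d - k) := by
          rw [mul_assoc, ← pow_add, Nat.add_sub_cancel' hkd]
      _ ≤ k.factorial * (k : ℝ) ^ (d - k) := by gcongr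
      _ ≤ _ := by exact_mod_cast hle
  have hsum' : ((Finset.univ.filter fun p : Fin d → Fin k =>
      Function.Injective fun j => p (i j)).card : ℝ) + ((Finset.univ.filter fun p : Fin d → Fin k =>
      ¬ Function.Injective fun j => p (i j)).card : ℝ) = (k : ℝ) ^ d := by exact_mod_cast hsum
  linarith

/-- A family that contains, for every tuple of coordinates, a partition separating them. -/
def IsSeparating {d k : ℕ} (A : PartitionFamily d k) : Prop :=
  ∀ i : Fin k ↪ Fin d, ∃ a, Function.Injective fun j => A a (i j)

theorem uniformOn_not_separating_le {d k : ℕ} (hd : 2 ≤ d) (hk : 1 ≤ k) (i : Fin k ↪ Fin d) :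
    uniformOn (Set.univ : Set (PartitionFamily d k))
      {A | ∀ a, ¬ Function.Injective fun j => A a (i j)} ≤
        ENNReal.ofReal (((d : ℝ) ^ k)⁻¹ * ((d : ℝ) ^ k)⁻¹) := by
  classical
  have hk0 : (0 : ℝ) < k := by exact_mod_cast hk
  have hd0 : (0 : ℝ) < d := by exact_mod_cast (by omega : 0 < d)
  set S : Finset (PartitionFamily d k) := Fintype.piFinset fun _ =>
    Finset.univ.filter fun p : Fin d → Fin k => ¬ Function.Injective fun j => p (i j) with hS
  have hset : {A : PartitionFamily d k | ∀ a, ¬ Function.Injective fun j => A a (i j)} = ↑S := by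
    ext A
    simp [hS]
  rw [hset, uniformOn_univ, Measure.count_apply_finset]
  have hcard : Fintype.card (PartitionFamily d k) = (k ^ d) ^ familySize d k := by
    simp
  have hScard : (S.card : ℝ) ≤ (((d : ℝ) ^ k)⁻¹ * ((d : ℝ) ^ k)⁻¹) * ((k : ℝ) ^ d) ^ familySize d k := by
    rw [hS, Fintype.card_piFinset]
    simp only [Finset.prod_const, Finset.card_univ, Fintype.card_fin, Nat.cast_pow]
    have h1 : 0 ≤ 1 - Real.exp (-k) := by
      have : Real.exp (-k) ≤ 1 := Real.exp_le_one_iff.2 (by linarith)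
      linarith
    calc _ ≤ ((1 - Real.exp (-k)) * (k : ℝ) ^ d) ^ familySize d k := by
          gcongr
          exact card_not_injective_comp_le hk i
      _ = (1 - Real.exp (-k)) ^ familySize d k * ((k : ℝ) ^ d) ^ familySize d k := mul_pow _ _ _
      _ ≤ _ := by
          gcongr
          calc (1 - Real.exp (-k)) ^ familySize d k
              ≤ Real.exp (-Real.exp (-k)) ^ familySize d k := by
                gcongr
                exact Real.one_sub_le_exp_neg _
            _ = Real.exp (-(familySize d k * Real.exp (-k))) := by
                rw [← Real.exp_nat_mul]; congr 1; ring
            _ ≤ Real.exp (-(2 * k * Real.log d)) := by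
                refine Real.exp_le_exp.2 (neg_le_neg ?_)
                calc 2 * k * Real.log d
                    = (2 * k * Real.exp k * Real.log d) * Real.exp (-k) := by
                      rw [Real.exp_neg]
                      have := Real.exp_pos (k : ℝ)
                      field_simp
                  _ ≤ _ := mul_le_mul_of_nonneg_right (Nat.le_ceil _) (Real.exp_pos _).le
            _ = _ := by
                rw [show -(2 * (k : ℝ) * Real.log d) = k * -Real.log d + k * -Real.log d by ring,
                  Real.exp_add, Real.exp_nat_mul, Real.exp_neg, Real.exp_log hd0, inv_pow]
  rw [hcard]
  have hpos : (0 : ℝ) < ((k : ℝ) ^ d) ^ familySize d k := by positivity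
  refine ENNReal.div_le_of_le_mul ?_
  have e1 : ((S.card : ℕ) : ENNReal) = ENNReal.ofReal (S.card : ℝ) := by simp
  have e2 : (((k ^ d) ^ familySize d k : ℕ) : ENNReal) =
      ENNReal.ofReal (((k : ℝ) ^ d) ^ familySize d k) := by
    rw [← ENNReal.ofReal_natCast]; push_cast; rfl
  rw [e1, e2, ← ENNReal.ofReal_mul (by positivity)]
  exact ENNReal.ofReal_le_ofReal hScard

/-- With probability at least `1 - d ^ (-k)`, all tuples of coordinates are separated. -/
theorem le_uniformOn_isSeparating {d k : ℕ} (hd : 2 ≤ d) (hk : 1 ≤ k) :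
    ENNReal.ofReal (1 - ((d : ℝ) ^ k)⁻¹) ≤
      uniformOn (Set.univ : Set (PartitionFamily d k)) {A | IsSeparating A} := by
  have : NeZero k := ⟨by omega⟩
  have hd0 : (0 : ℝ) < d := by exact_mod_cast (by omega : 0 < d)
  have : IsProbabilityMeasure (uniformOn (Set.univ : Set (PartitionFamily d k))) :=
    isProbabilityMeasure_uniformOn Set.finite_univ Set.univ_nonempty
  set P := uniformOn (Set.univ : Set (PartitionFamily d k)) with hP
  have hbad : P {A | IsSeparating A}ᶜ ≤ ENNReal.ofReal (((d : ℝ) ^ k)⁻¹) := by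
    have hsub : {A : PartitionFamily d k | IsSeparating A}ᶜ ⊆
        ⋃ i : Fin k ↪ Fin d, {A | ∀ a, ¬ Function.Injective fun j => A a (i j)} := by
      intro A hA
      simp only [IsSeparating, Set.mem_compl_iff, Set.mem_ofPred_eq, not_forall, not_exists] at hA
      simpa using hA
    refine (measure_mono hsub).trans ((measure_iUnion_fintype_le _ _).trans ?_)
    refine (Finset.sum_le_sum fun i _ => uniformOn_not_separating_le hd hk i).trans ?_
    rw [Finset.sum_const, Finset.card_univ, nsmul_eq_mul, ← ENNReal.ofReal_natCast,
      ← ENNReal.ofReal_mul (Nat.cast_nonneg _)]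
    refine ENNReal.ofReal_le_ofReal ?_
    have hc : (Fintype.card (Fin k ↪ Fin d) : ℝ) ≤ (d : ℝ) ^ k := by
      have := Nat.descFactorial_le_pow d k
      rw [Fintype.card_embedding_eq, Fintype.card_fin, Fintype.card_fin]
      exact_mod_cast this
    have hp : (0 : ℝ) < (d : ℝ) ^ k := by positivity
    calc _ ≤ (d : ℝ) ^ k * (((d : ℝ) ^ k)⁻¹ * ((d : ℝ) ^ k)⁻¹) := by gcongr
      _ = _ := by field_simp
  have hcompl := prob_compl_eq_one_sub (μ := P)
    (Set.toFinite {A : PartitionFamily d k | IsSeparating A}).measurableSet.compl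
  rw [compl_compl] at hcompl
  rw [hcompl, ENNReal.ofReal_sub _ (by positivity), ENNReal.ofReal_one]
  exact tsub_le_tsub_left hbad _

end ContinuumBandit

namespace ContinuumBandit

/-! ### Locally Hölder continuous functions on the cube -/

theorem euclDist_le {k : ℕ} {u v : Cube k} {ε : ℝ} (hε : 0 ≤ ε)
    (h : ∀ j, |(u j : ℝ) - v j| ≤ ε) : euclDist u v ≤ √k * ε := by
  unfold euclDist
  rw [EuclideanSpace.norm_eq]
  calc √(∑ j : Fin k, ‖(u j : ℝ) - v j‖ ^ 2) ≤ √(∑ j : Fin k, ε ^ 2) := by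
        gcongr with j
        exact h j
    _ = √k * ε := by
        rw [Finset.sum_const, Finset.card_univ, Fintype.card_fin, nsmul_eq_mul,
          Real.sqrt_mul (Nat.cast_nonneg _), Real.sqrt_sq hε]

theorem euclDist_nonneg {k : ℕ} (u v : Cube k) : 0 ≤ euclDist u v := norm_nonneg _

theorem continuous_euclDist {k : ℕ} (v : Cube k) : Continuous fun u => euclDist u v := by
  unfold euclDist
  refine continuous_norm.comp ((PiLp.continuous_toLp 2 _).comp ?_)
  fun_prop

theorem euclDist_self {k : ℕ} (v : Cube k) : euclDist v v = 0 := by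
  simp only [euclDist, sub_self]
  exact norm_zero

theorem IsLocHolder.continuous {α L δ : ℝ} (hα : 0 < α) (hδ : 0 < δ) {k : ℕ} {f : Cube k → ℝ}
    (hf : IsLocHolder α L δ f) : Continuous f := by
  refine continuous_iff_continuousAt.2 fun v => ?_
  have h0 : Filter.Tendsto (fun u => euclDist u v) (nhds v) (nhds 0) := by
    have := (continuous_euclDist v).tendsto v
    rwa [euclDist_self] at this
  have h1 : Filter.Tendsto (fun u => L * euclDist u v ^ α) (nhds v) (nhds 0) := by
    have := (h0.rpow_const (p := α) (Or.inr hα.le)).const_mul L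
    rwa [Real.zero_rpow hα.ne', mul_zero] at this
  refine tendsto_iff_dist_tendsto_zero.2 (squeeze_zero' (.of_forall fun _ => dist_nonneg) ?_ h1)
  filter_upwards [h0.eventually (gt_mem_nhds hδ)] with u hu
  exact hf u v hu.le

/-- A locally Hölder continuous function on the cube has a bounded range. -/
theorem IsLocHolder.abs_sub_le {α L δ : ℝ} (hα : 0 < α) (hL : 0 ≤ L) (hδ : 0 < δ) {k : ℕ}
    {f : Cube k → ℝ} (hf : IsLocHolder α L δ f) (u v : Cube k) :
    |f u - f v| ≤ (⌈√k / δ⌉₊ + 1 : ℕ) * (L * δ ^ α) := by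
  set q := ⌈√k / δ⌉₊ + 1 with hq
  have hq0 : (0 : ℝ) < q := by positivity
  let w : ℕ → Cube k := fun l j =>
    Set.projIcc 0 1 zero_le_one ((u j : ℝ) + (l / q : ℝ) * ((v j : ℝ) - u j))
  have hw0 : w 0 = u := by
    funext j
    simp [w, Set.projIcc_val]
  have hwq : w q = v := by
    funext j
    simp only [w]
    rw [div_self hq0.ne', one_mul, add_sub_cancel, Set.projIcc_val]
  have hstep : ∀ l, |f (w l) - f (w (l + 1))| ≤ L * δ ^ α := fun l => by
    have hd : euclDist (w l) (w (l + 1)) ≤ δ := by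
      refine (euclDist_le (ε := 1 / q) (by positivity) fun j => ?_).trans ?_
      · refine (Set.abs_projIcc_sub_projIcc zero_le_one).trans ?_
        have : (u j : ℝ) + (l / q : ℝ) * ((v j : ℝ) - u j) -
            ((u j : ℝ) + (((l + 1 : ℕ) : ℝ) / q) * ((v j : ℝ) - u j)) =
            (1 / q) * ((u j : ℝ) - v j) := by
          push_cast
          ring
        rw [this, abs_mul, abs_of_pos (by positivity : (0 : ℝ) < 1 / q)]
        refine mul_le_of_le_one_right (by positivity) (abs_le.2 ⟨?_, ?_⟩)
        · linarith [(u j).2.1, (v j).2.2]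
        · linarith [(u j).2.2, (v j).2.1]
      · rw [mul_one_div, div_le_iff₀ hq0, mul_comm, ← div_le_iff₀ hδ, hq]
        push_cast
        linarith [Nat.le_ceil (√(k : ℝ) / δ)]
    refine (hf _ _ hd).trans ?_
    gcongr
    exact euclDist_nonneg _ _
  have hind : ∀ n : ℕ, |f (w 0) - f (w n)| ≤ n * (L * δ ^ α) := fun n => by
    induction n with
    | zero => simp
    | succ n ih =>
      have := _root_.abs_sub_le (f (w 0)) (f (w n)) (f (w (n + 1)))
      push_cast
      linarith [hstep n]
  have := hind q
  rwa [hw0, hwq] at this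

/-- A common bound, at least one, for the ranges of functions in the class. -/
noncomputable def rangeBound (α L δ : ℝ) (k : ℕ) : ℝ := (⌈√k / δ⌉₊ + 1 : ℕ) * (L * δ ^ α) + 1

theorem one_le_rangeBound {α L δ : ℝ} (hL : 0 ≤ L) (hδ : 0 < δ) (k : ℕ) :
    1 ≤ rangeBound α L δ k := by
  unfold rangeBound
  have : 0 ≤ ((⌈√k / δ⌉₊ + 1 : ℕ) : ℝ) * (L * δ ^ α) := by positivity
  linarith

theorem continuous_liftReward {d k : ℕ} (i : Fin k ↪ Fin d) {f : Cube k → ℝ} (hf : Continuous f) :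
    Continuous (liftReward i f) := by
  unfold liftReward
  fun_prop

theorem exists_forall_le_of_continuous {d : ℕ} {F : Cube d → ℝ} (hF : Continuous F) :
    ∃ x, ∀ y, F y ≤ F x := by
  obtain ⟨x, -, hx⟩ := isCompact_univ.exists_isMaxOn (Set.univ_nonempty (α := Cube d))
    hF.continuousOn
  exact ⟨x, fun y => hx (Set.mem_univ y)⟩

/-! ### Approximation by the strategy sets -/

theorem exists_grid_near {M : ℕ} (hM : 0 < M) (t : unitInterval) :
    ∃ b : Fin M, |(t : ℝ) - ((b : ℕ) + 1) / M| ≤ 1 / M := by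
  have hM0 : (0 : ℝ) < M := by exact_mod_cast hM
  have hle : ⌈(t : ℝ) * M⌉₊ - 1 < M := by
    have : ⌈(t : ℝ) * M⌉₊ ≤ M := Nat.ceil_le.2 (mul_le_of_le_one_left hM0.le t.2.2)
    omega
  refine ⟨⟨⌈(t : ℝ) * M⌉₊ - 1, hle⟩, ?_⟩
  have hx0 : 0 ≤ (t : ℝ) * M := mul_nonneg t.2.1 hM0.le
  have key : |(t : ℝ) * M - (((⌈(t : ℝ) * M⌉₊ - 1 : ℕ) : ℝ) + 1)| ≤ 1 := by
    rcases Nat.eq_zero_or_pos ⌈(t : ℝ) * M⌉₊ with h | h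
    · have : (t : ℝ) * M ≤ 0 := Nat.ceil_eq_zero.1 h
      rw [h, le_antisymm this hx0]
      simp
    · have h1 : (((⌈(t : ℝ) * M⌉₊ - 1 : ℕ) : ℝ) + 1) = ⌈(t : ℝ) * M⌉₊ := by
        exact_mod_cast Nat.sub_add_cancel h
      rw [h1, abs_le]
      constructor
      · linarith [Nat.ceil_lt_add_one hx0]
      · linarith [Nat.le_ceil ((t : ℝ) * M)]
  have : (t : ℝ) - (((⌈(t : ℝ) * M⌉₊ - 1 : ℕ) : ℝ) + 1) / M =
      ((t : ℝ) * M - (((⌈(t : ℝ) * M⌉₊ - 1 : ℕ) : ℝ) + 1)) / M := by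
    field_simp
  simp only [this, abs_div, abs_of_pos hM0]
  gcongr

theorem strategySet_nonempty {d k M : ℕ} (A : PartitionFamily d k) (hm : 0 < familySize d k)
    (hM : 0 < M) : (strategySet A M).Nonempty := by
  classical
  unfold strategySet
  exact ⟨_, Finset.mem_image_of_mem _ (Finset.mem_univ (⟨0, hm⟩, fun _ => ⟨0, hM⟩))⟩

theorem card_strategySet_le {d k M : ℕ} (A : PartitionFamily d k) :
    (strategySet A M).card ≤ familySize d k * M ^ k := by
  classical
  unfold strategySet
  refine Finset.card_image_le.trans ?_
  simp

/-- If a partition of the family separates the active coordinates, the strategy set contains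
strategies close to any given one in the active coordinates. -/
theorem exists_mem_strategySet_near {d k M : ℕ} (hM : 0 < M) {A : PartitionFamily d k}
    {i : Fin k ↪ Fin d} (hA : ∃ a, Function.Injective fun j => A a (i j)) (x : Cube d) :
    ∃ y ∈ strategySet A M, euclDist (fun j => x (i j)) (fun j => y (i j)) ≤ √k / M := by
  classical
  obtain ⟨a, ha⟩ := hA
  choose b hb using fun j => exists_grid_near hM (x (i j))
  let e := Equiv.ofBijective _ (Finite.injective_iff_bijective.1 ha)
  refine ⟨gridPoint (A a) fun l => b (e.symm l),
    Finset.mem_image_of_mem (fun q : Fin (familySize d k) × (Fin k → Fin M) =>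
      gridPoint (A q.1) q.2) (Finset.mem_univ (a, fun l => b (e.symm l))), ?_⟩
  rw [← mul_one_div]
  refine euclDist_le (by positivity) fun j => ?_
  have : e.symm (A a (i j)) = j := e.symm_apply_apply j
  simp only [gridPoint, this]
  exact hb j

/-- The discretization error. -/
theorem exists_mem_strategySet_le {α L δ : ℝ} (hα : 0 < α) (hL : 0 ≤ L) {d k M : ℕ} (hM : 0 < M)
    {A : PartitionFamily d k} {i : Fin k ↪ Fin d} (hA : ∃ a, Function.Injective fun j => A a (i j))
    (hMδ : √k / M ≤ δ) (x : Cube d) :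
    ∃ y ∈ strategySet A M, ∀ f : Cube k → ℝ, IsLocHolder α L δ f →
      liftReward i f x ≤ liftReward i f y + L * (√k / M) ^ α := by
  obtain ⟨y, hy, hxy⟩ := exists_mem_strategySet_near hM hA x
  refine ⟨y, hy, fun f hf => ?_⟩
  have h1 := (le_abs_self _).trans (hf _ _ (hxy.trans hMδ))
  have h2 : euclDist (fun j => x (i j)) (fun j => y (i j)) ^ α ≤ (√k / M) ^ α :=
    Real.rpow_le_rpow (euclDist_nonneg _ _) hxy hα.le
  unfold liftReward
  have := mul_le_mul_of_nonneg_left h2 hL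
  linarith

end ContinuumBandit

namespace ContinuumBandit

/-! ### Restarting a policy -/

theorem pmf_bind_congr {X Y : Type*} {p : PMF X} {f g : X → PMF Y}
    (h : ∀ x ∈ p.support, f x = g x) : p.bind f = p.bind g := by
  ext y
  rw [PMF.bind_apply, PMF.bind_apply]
  refine tsum_congr fun x => ?_
  by_cases hx : p x = 0
  · rw [hx, zero_mul, zero_mul]
  · rw [h x hx]

section restart

variable {X : Type*}

theorem length_of_mem_support_historyLaw {π : Policy X} {r : ℕ → X → ℝ} {t : ℕ} :
    ∀ h ∈ (historyLaw π r t).support, h.length = t := by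
  induction t with
  | zero =>
    intro h hh
    rw [historyLaw, PMF.support_pure, Set.mem_singleton_iff] at hh
    rw [hh, List.length_nil]
  | succ t ih =>
    intro h hh
    rw [historyLaw, PMF.mem_support_bind_iff] at hh
    obtain ⟨h', hh', hx⟩ := hh
    rw [PMF.mem_support_map_iff] at hx
    obtain ⟨x, -, rfl⟩ := hx
    rw [List.length_append, ih h' hh', List.length_singleton]

variable {π π' : Policy X} {r : ℕ → X → ℝ} {a b : ℕ}

theorem map_drop_historyLaw
    (hπ : ∀ h : List (X × ℝ), a ≤ h.length → h.length < a + b → π h = π' (h.drop a)) :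
    ∀ s ≤ b, (historyLaw π r (a + s)).map (List.drop a) = historyLaw π' (fun u => r (a + u)) s
  | 0, _ => by
    rw [historyLaw, PMF.map]
    have : (historyLaw π r (a + 0)).bind (PMF.pure ∘ List.drop a) =
        (historyLaw π r (a + 0)).bind fun _ => PMF.pure [] :=
      pmf_bind_congr fun h hh => by
        rw [Function.comp_apply, List.drop_of_length_le
            (show h.length ≤ a from (length_of_mem_support_historyLaw h hh).le)]
    rw [this, PMF.bind_const]
  | s + 1, hs => by
    rw [historyLaw, ← map_drop_historyLaw hπ s (by omega), ← add_assoc, historyLaw, PMF.map_bind,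
      PMF.bind_map]
    refine pmf_bind_congr fun h hh => ?_
    have hl := length_of_mem_support_historyLaw h hh
    rw [Function.comp_apply, PMF.map_comp, hπ h (by omega) (by omega)]
    congr 1
    funext x
    rw [Function.comp_apply, List.drop_append_of_le_length (by omega)]

theorem playLaw_restart
    (hπ : ∀ h : List (X × ℝ), a ≤ h.length → h.length < a + b → π h = π' (h.drop a)) {s : ℕ}
    (hs : s < b) : playLaw π r (a + s + 1) = playLaw π' (fun u => r (a + u)) (s + 1) := by
  rw [playLaw, playLaw, Nat.add_sub_cancel, Nat.add_sub_cancel,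
    ← map_drop_historyLaw hπ s hs.le, PMF.bind_map]
  refine pmf_bind_congr fun h hh => ?_
  have hl := length_of_mem_support_historyLaw h hh
  rw [Function.comp_apply, hπ h (by omega) (by omega)]

theorem roundReward_restart
    (hπ : ∀ h : List (X × ℝ), a ≤ h.length → h.length < a + b → π h = π' (h.drop a)) {s : ℕ}
    (hs : s < b) : roundReward π r (a + s + 1) = roundReward π' (fun u => r (a + u)) (s + 1) := by
  rw [roundReward, roundReward, playLaw_restart hπ hs]
  rfl

end restart

theorem roundReward_cab {d k : ℕ} (mab : Finset (Cube d) → ℕ → Policy (Cube d)) (α : ℝ)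
    (A : PartitionFamily d k) (r : ℕ → Cube d → ℝ) {j s : ℕ} (hs : s < 2 ^ j) :
    roundReward (cab mab α A) r (2 ^ j + s) =
      roundReward (mab (strategySet A (gridSize α d k (2 ^ j))) (2 ^ j))
        (fun u => r (2 ^ j - 1 + u)) (s + 1) := by
  have hj : 1 ≤ 2 ^ j := Nat.one_le_two_pow
  rw [show 2 ^ j + s = 2 ^ j - 1 + s + 1 by omega]
  refine roundReward_restart (b := 2 ^ j) (fun h h1 h2 => ?_) hs
  have hlog : Nat.log 2 (h.length + 1) = j :=
    Nat.log_eq_of_pow_le_of_lt_pow (by omega) (by rw [pow_succ]; omega)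
  simp only [cab, hlog]

end ContinuumBandit

namespace ContinuumBandit

/-! ### Expectations of distributions with finite support -/

/-- The expectation of a real function under a distribution. -/
noncomputable def pmfExp {X : Type*} (p : PMF X) (f : X → ℝ) : ℝ := ∑' x, (p x).toReal * f x

section pmfExp

variable {X Y : Type*} {p : PMF X} {f g : X → ℝ}

theorem pmfExp_eq_sum {s : Finset X} (hs : p.support ⊆ s) (f : X → ℝ) :
    pmfExp p f = ∑ x ∈ s, (p x).toReal * f x := by
  refine tsum_eq_sum fun x hx => ?_
  have : p x = 0 := by
    by_contra h
    exact hx (hs h)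
  rw [this, ENNReal.toReal_zero, zero_mul]

theorem pmfExp_pure (x : X) (f : X → ℝ) : pmfExp (PMF.pure x) f = f x := by
  rw [pmfExp_eq_sum (s := {x}) (by rw [PMF.support_pure, Finset.coe_singleton]),
    Finset.sum_singleton, PMF.pure_apply_self, ENNReal.toReal_one, one_mul]

theorem pmfExp_bind {q : X → PMF Y} (hp : p.support.Finite)
    (hq : ∀ x ∈ p.support, (q x).support.Finite) (f : Y → ℝ) :
    pmfExp (p.bind q) f = pmfExp p fun x => pmfExp (q x) f := by
  have hb : (p.bind q).support.Finite := by
    rw [PMF.support_bind]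
    exact hp.biUnion hq
  have hS : p.support ⊆ hp.toFinset := by rw [hp.coe_toFinset]
  rw [pmfExp_eq_sum (s := hb.toFinset) (by rw [hb.coe_toFinset]), pmfExp_eq_sum hS]
  have h1 : ∀ y, ((p.bind q) y).toReal = ∑ x ∈ hp.toFinset, (p x).toReal * (q x y).toReal := by
    intro y
    rw [PMF.bind_apply, tsum_eq_sum (s := hp.toFinset), ENNReal.toReal_sum]
    · simp_rw [ENNReal.toReal_mul]
    · exact fun x _ => ENNReal.mul_ne_top (p.apply_ne_top x) ((q x).apply_ne_top y)
    · intro x hx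
      have : p x = 0 := by
        by_contra h
        exact hx (hS h)
      rw [this, zero_mul]
  simp_rw [h1, Finset.sum_mul]
  rw [Finset.sum_comm]
  refine Finset.sum_congr rfl fun x hx => ?_
  have hx' : x ∈ p.support := by rwa [hp.mem_toFinset] at hx
  rw [pmfExp_eq_sum (s := hb.toFinset), Finset.mul_sum]
  · exact Finset.sum_congr rfl fun y _ => mul_assoc _ _ _
  · rw [hb.coe_toFinset, PMF.support_bind]
    exact Set.subset_biUnion_of_mem (u := fun x => (q x).support) hx'

theorem support_map_finite (hp : p.support.Finite) (φ : X → Y) : (p.map φ).support.Finite := by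
  rw [PMF.support_map]
  exact hp.image φ

theorem pmfExp_map (hp : p.support.Finite) (φ : X → Y) (f : Y → ℝ) :
    pmfExp (p.map φ) f = pmfExp p fun x => f (φ x) := by
  rw [PMF.map, pmfExp_bind hp fun x _ => by
    rw [Function.comp_apply, PMF.support_pure]; exact Set.finite_singleton _]
  simp_rw [Function.comp_apply, pmfExp_pure]

theorem pmfExp_add (hp : p.support.Finite) (f g : X → ℝ) :
    pmfExp p (fun x => f x + g x) = pmfExp p f + pmfExp p g := by
  have hS : p.support ⊆ hp.toFinset := by rw [hp.coe_toFinset]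
  rw [pmfExp_eq_sum hS, pmfExp_eq_sum hS, pmfExp_eq_sum hS, ← Finset.sum_add_distrib]
  simp_rw [mul_add]

theorem pmfExp_const_mul (hp : p.support.Finite) (c : ℝ) (f : X → ℝ) :
    pmfExp p (fun x => c * f x) = c * pmfExp p f := by
  have hS : p.support ⊆ hp.toFinset := by rw [hp.coe_toFinset]
  rw [pmfExp_eq_sum hS, pmfExp_eq_sum hS, Finset.mul_sum]
  exact Finset.sum_congr rfl fun x _ => mul_left_comm _ _ _

theorem pmfExp_const (hp : p.support.Finite) (c : ℝ) : pmfExp p (fun _ => c) = c := by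
  have hS : p.support ⊆ hp.toFinset := by rw [hp.coe_toFinset]
  have h1 : ∑ x ∈ hp.toFinset, p x = 1 := by
    rw [← tsum_eq_sum (L := SummationFilter.unconditional X) fun x hx => ?_, p.tsum_coe]
    by_contra h
    exact hx (hS h)
  rw [pmfExp_eq_sum hS, ← Finset.sum_mul, ← ENNReal.toReal_sum fun x _ => p.apply_ne_top x, h1,
    ENNReal.toReal_one, one_mul]

theorem pmfExp_mono (hp : p.support.Finite) (h : ∀ x ∈ p.support, f x ≤ g x) :
    pmfExp p f ≤ pmfExp p g := by
  have hS : p.support ⊆ hp.toFinset := by rw [hp.coe_toFinset]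
  rw [pmfExp_eq_sum hS, pmfExp_eq_sum hS]
  refine Finset.sum_le_sum fun x hx => mul_le_mul_of_nonneg_left (h x ?_) ENNReal.toReal_nonneg
  rwa [hp.mem_toFinset] at hx

end pmfExp

section history

variable {X : Type*} {π : Policy X} {r : ℕ → X → ℝ}

theorem historyLaw_support_finite (hπ : ∀ h, (π h).support.Finite) (t : ℕ) :
    (historyLaw π r t).support.Finite := by
  induction t with
  | zero => rw [historyLaw, PMF.support_pure]; exact Set.finite_singleton _
  | succ t ih =>
    rw [historyLaw, PMF.support_bind]
    exact ih.biUnion fun h _ => support_map_finite (hπ h) _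

theorem pmfExp_historyLaw_succ (hπ : ∀ h, (π h).support.Finite) (t : ℕ)
    (f : List (X × ℝ) → ℝ) :
    pmfExp (historyLaw π r (t + 1)) f =
      pmfExp (historyLaw π r t) fun h => pmfExp (π h) fun x => f (h ++ [(x, r (t + 1) x)]) := by
  rw [historyLaw, pmfExp_bind (historyLaw_support_finite hπ t) fun h _ =>
    support_map_finite (hπ h) _]
  simp_rw [pmfExp_map (hπ _)]

theorem roundReward_succ (hπ : ∀ h, (π h).support.Finite) (t : ℕ) :
    roundReward π r (t + 1) =
      pmfExp (historyLaw π r t) fun h => pmfExp (π h) (r (t + 1)) := by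
  change pmfExp ((historyLaw π r t).bind π) _ = _
  exact pmfExp_bind (historyLaw_support_finite hπ t) (fun h _ => hπ h) _

theorem roundReward_nonneg (hr : ∀ t x, 0 ≤ r t x) (t : ℕ) : 0 ≤ roundReward π r t :=
  tsum_nonneg fun x => mul_nonneg ENNReal.toReal_nonneg (hr t x)

end history

/-! ### The regret of Exp3 -/

section exp3

variable {X : Type*} {P : Finset X} {γ : ℝ}

/-- The logarithm of the total weight. -/
noncomputable def exp3Potential (P : Finset X) (γ : ℝ) (S : X → ℝ) : ℝ :=
  Real.log (∑ y ∈ P, Real.exp (γ * S y / P.card))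

open scoped Classical in
/-- The update of the estimates. -/
noncomputable def exp3Step (P : Finset X) (γ : ℝ) (S : X → ℝ) (x : X) (ρ : ℝ) : X → ℝ :=
  fun y => S y + if y = x then ρ / exp3Prob P γ S x else 0

theorem exp3Estimate_append (P : Finset X) (γ : ℝ) (h : List (X × ℝ)) (x : X) (ρ : ℝ) :
    exp3Estimate P γ (h ++ [(x, ρ)]) = exp3Step P γ (exp3Estimate P γ h) x ρ := by
  rw [exp3Estimate, List.foldl_append]
  rfl

theorem exp3_weight_pos (hP : P.Nonempty) (S : X → ℝ) :
    0 < ∑ y ∈ P, Real.exp (γ * S y / P.card) :=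
  Finset.sum_pos (fun _ _ => Real.exp_pos _) hP

theorem le_exp3Prob (hP : P.Nonempty) (h1 : γ ≤ 1) (S : X → ℝ) (x : X) :
    γ / P.card ≤ exp3Prob P γ S x :=
  le_add_of_nonneg_left (mul_nonneg (by linarith)
    (div_nonneg (Real.exp_pos _).le (exp3_weight_pos hP S).le))

theorem exp3_step_le (hP : P.Nonempty) (h0 : 0 < γ) (h1 : γ ≤ 1) (S : X → ℝ) {ρ : X → ℝ}
    (hρ : ∀ x, ρ x ∈ Set.Icc (0 : ℝ) 1) :
    ∑ x ∈ P, exp3Prob P γ S x *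
        ((1 - γ) * (exp3Potential P γ (exp3Step P γ S x (ρ x)) - exp3Potential P γ S)) ≤
      γ / P.card * ∑ x ∈ P, exp3Prob P γ S x * ρ x + γ ^ 2 / P.card := by
  classical
  have hK : (0 : ℝ) < P.card := by exact_mod_cast hP.card_pos
  set W := ∑ y ∈ P, Real.exp (γ * S y / P.card) with hW
  have hW0 : 0 < W := exp3_weight_pos hP S
  have hterm : ∀ x ∈ P, exp3Prob P γ S x *
        ((1 - γ) * (exp3Potential P γ (exp3Step P γ S x (ρ x)) - exp3Potential P γ S)) ≤
      γ / P.card * (exp3Prob P γ S x * ρ x) + γ ^ 2 / (P.card : ℝ) ^ 2 := by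
    intro x hx
    set p := exp3Prob P γ S x with hp
    have hpK : γ / P.card ≤ p := le_exp3Prob hP h1 S x
    have hp0 : 0 < p := lt_of_lt_of_le (by positivity) hpK
    set w := Real.exp (γ * S x / P.card) with hw
    have hw0 : 0 < w := Real.exp_pos _
    set η := γ * ρ x / (P.card * p) with hη
    have hη0 : 0 ≤ η := div_nonneg (mul_nonneg h0.le (hρ x).1) (by positivity)
    have hη1 : η ≤ 1 := by
      rw [hη, div_le_one (by positivity)]
      rw [div_le_iff₀ hK] at hpK
      nlinarith [(hρ x).1, (hρ x).2]
    have hexp : Real.exp η - 1 ≤ η + η ^ 2 := by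
      have := (abs_le.1 (Real.abs_exp_sub_one_sub_id_le (abs_le.2 ⟨by linarith, hη1⟩))).2
      linarith
    have hexp0 : 0 ≤ Real.exp η - 1 := by linarith [Real.one_le_exp hη0]
    have hsum : ∑ y ∈ P, Real.exp (γ * exp3Step P γ S x (ρ x) y / P.card) =
        W + w * (Real.exp η - 1) := by
      have : ∀ y ∈ P, Real.exp (γ * exp3Step P γ S x (ρ x) y / P.card) =
          Real.exp (γ * S y / P.card) + if y = x then w * (Real.exp η - 1) else 0 := by
        intro y _
        unfold exp3Step
        split_ifs with hyx
        · subst hyx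
          rw [mul_sub, mul_one, hw, ← Real.exp_add, hη]
          rw [add_sub_cancel]
          congr 1
          rw [← hp]
          field_simp
        · simp
      rw [Finset.sum_congr rfl this, Finset.sum_add_distrib, Finset.sum_ite_eq' P x, if_pos hx]
    have hlog : exp3Potential P γ (exp3Step P γ S x (ρ x)) - exp3Potential P γ S ≤
        w / W * (η + η ^ 2) := by
      unfold exp3Potential
      rw [hsum, ← hW, ← Real.log_div (by positivity) hW0.ne']
      refine (Real.log_le_sub_one_of_pos (by positivity)).trans ?_
      have : (W + w * (Real.exp η - 1)) / W - 1 = w / W * (Real.exp η - 1) := by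
        field_simp
        ring
      rw [this]
      gcongr
    have hwp : (1 - γ) * (w / W) ≤ p := by
      rw [hp, exp3Prob, ← hW, ← hw]
      linarith [div_pos h0 hK]
    have hpη : p * η = γ * ρ x / P.card := by
      rw [hη]
      field_simp
    have hρ2 : (γ * ρ x / P.card) ^ 2 ≤ γ ^ 2 / (P.card : ℝ) ^ 2 := by
      rw [div_pow, mul_pow]
      gcongr
      exact mul_le_of_le_one_right (sq_nonneg _) (pow_le_one₀ (hρ x).1 (hρ x).2)
    calc p * ((1 - γ) * (exp3Potential P γ (exp3Step P γ S x (ρ x)) - exp3Potential P γ S))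
        ≤ p * ((1 - γ) * (w / W * (η + η ^ 2))) := by
          have : 0 ≤ 1 - γ := by linarith
          gcongr
      _ = p * ((1 - γ) * (w / W)) * (η + η ^ 2) := by ring
      _ ≤ p * p * (η + η ^ 2) := by gcongr
      _ = p * (p * η) + (p * η) ^ 2 := by ring
      _ ≤ _ := by
          rw [hpη]
          have : p * (γ * ρ x / P.card) = γ / P.card * (p * ρ x) := by ring
          linarith
  refine (Finset.sum_le_sum hterm).trans (le_of_eq ?_)
  rw [Finset.sum_add_distrib, ← Finset.mul_sum, Finset.sum_const, nsmul_eq_mul]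
  field_simp

theorem exp3_step_mean (hP : P.Nonempty) (h0 : 0 < γ) (h1 : γ ≤ 1) (S ρ : X → ℝ) {a : X}
    (ha : a ∈ P) :
    ∑ x ∈ P, exp3Prob P γ S x * (exp3Step P γ S x (ρ x) a - S a) = ρ a := by
  classical
  have hK : (0 : ℝ) < P.card := by exact_mod_cast hP.card_pos
  have hp0 : 0 < exp3Prob P γ S a := lt_of_lt_of_le (by positivity) (le_exp3Prob hP h1 S a)
  rw [Finset.sum_eq_single_of_mem a ha]
  · simp only [exp3Step, if_true]
    field_simp
    ring
  · intro x _ hx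
    simp [exp3Step, hx.symm]

theorem le_exp3Potential (S : X → ℝ) {a : X} (ha : a ∈ P) :
    γ / P.card * S a ≤ exp3Potential P γ S := by
  unfold exp3Potential
  rw [Real.le_log_iff_exp_le (exp3_weight_pos ⟨a, ha⟩ S), div_mul_eq_mul_div]
  exact Finset.single_le_sum (f := fun y => Real.exp (γ * S y / P.card))
    (fun y _ => (Real.exp_pos _).le) ha

variable [Nonempty X] {T : ℕ}

theorem exp3_support_subset (hP : P.Nonempty) (h : List (X × ℝ)) :
    (exp3 P T h).support ⊆ P := by
  intro x hx
  rw [PMF.mem_support_iff, exp3, dif_pos hP, PMF.ofFinset_apply] at hx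
  by_contra hxP
  exact hx (exp3Mass_of_notMem _ _ _ _ hxP)

theorem exp3_support_finite (hP : P.Nonempty) (h : List (X × ℝ)) :
    (exp3 P T h).support.Finite :=
  P.finite_toSet.subset (exp3_support_subset hP h)

theorem pmfExp_exp3 (hP : P.Nonempty) (h : List (X × ℝ)) (f : X → ℝ) :
    pmfExp (exp3 P T h) f = ∑ x ∈ P, exp3Prob P (exp3Gamma P.card T)
      (exp3Estimate P (exp3Gamma P.card T) h) x * f x := by
  rw [pmfExp_eq_sum (exp3_support_subset hP h)]
  refine Finset.sum_congr rfl fun x hx => ?_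
  rw [exp3, dif_pos hP, PMF.ofFinset_apply, exp3Mass, if_pos hx, ENNReal.toReal_ofReal]
  exact (div_nonneg (exp3Gamma_nonneg _ _) (Nat.cast_nonneg _)).trans
    (le_exp3Prob hP (exp3Gamma_le_one _ _) _ _)

/-- The regret of Exp3 in terms of the exploration parameter. -/
theorem exp3_regret_le_gamma {r : ℕ → X → ℝ} (hr : ∀ t x, r t x ∈ Set.Icc (0 : ℝ) 1) {a : X}
    (ha : a ∈ P) (h0 : 0 < exp3Gamma P.card T) (τ : ℕ) :
    ∑ s ∈ Finset.range τ, (r (s + 1) a - roundReward (exp3 P T) r (s + 1)) ≤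
      2 * exp3Gamma P.card T * τ + P.card * Real.log P.card / exp3Gamma P.card T := by
  have hP : P.Nonempty := ⟨a, ha⟩
  have hK : (0 : ℝ) < P.card := by exact_mod_cast hP.card_pos
  have h1 := exp3Gamma_le_one P.card T
  set γ := exp3Gamma P.card T with hγ
  have hfin := fun h => exp3_support_finite (T := T) hP h
  have hH := fun t => historyLaw_support_finite (r := r) hfin t
  have hexp3 : ∀ h f, pmfExp (exp3 P T h) f =
      ∑ x ∈ P, exp3Prob P γ (exp3Estimate P γ h) x * f x := fun h f => pmfExp_exp3 hP h f
  set H := fun t => historyLaw (exp3 P T) r t with hHdef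
  set u : ℕ → ℝ := fun t => pmfExp (H t) fun h => exp3Potential P γ (exp3Estimate P γ h) with hu
  set v : ℕ → ℝ := fun t => pmfExp (H t) fun h => exp3Estimate P γ h a with hv
  have hvstep : ∀ t, v (t + 1) = v t + r (t + 1) a := by
    intro t
    simp only [hv, hHdef]
    rw [pmfExp_historyLaw_succ hfin, ← pmfExp_const (hH t) (r (t + 1) a), ← pmfExp_add (hH t)]
    congr 1
    funext h
    rw [← exp3_step_mean hP h0 h1 (exp3Estimate P γ h) (r (t + 1)) ha,
      ← hexp3, ← pmfExp_const (hfin h) (exp3Estimate P γ h a), ← pmfExp_add (hfin h)]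
    congr 1
    funext x
    rw [exp3Estimate_append, pmfExp_const (hfin h)]
    ring
  have hustep : ∀ t, (1 - γ) * (u (t + 1) - u t) ≤
      γ / P.card * roundReward (exp3 P T) r (t + 1) + γ ^ 2 / P.card := by
    intro t
    have e1 : (1 - γ) * (u (t + 1) - u t) = pmfExp (H t) fun h => pmfExp (exp3 P T h) fun x =>
        (1 - γ) * (exp3Potential P γ (exp3Step P γ (exp3Estimate P γ h) x (r (t + 1) x)) -
          exp3Potential P γ (exp3Estimate P γ h)) := by
      simp_rw [pmfExp_const_mul (hfin _)]
      rw [pmfExp_const_mul (hH t)]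
      congr 1
      rw [sub_eq_iff_eq_add]
      simp only [hu, hHdef]
      rw [pmfExp_historyLaw_succ hfin, ← pmfExp_add (hH t)]
      congr 1
      funext h
      rw [← pmfExp_const (hfin h) (exp3Potential P γ (exp3Estimate P γ h)), ← pmfExp_add (hfin h)]
      congr 1
      funext x
      rw [exp3Estimate_append, pmfExp_const (hfin h)]
      ring
    have e2 : γ / P.card * roundReward (exp3 P T) r (t + 1) + γ ^ 2 / P.card =
        pmfExp (H t) fun h => γ / P.card * pmfExp (exp3 P T h) (r (t + 1)) + γ ^ 2 / P.card := by
      rw [pmfExp_add (hH t), pmfExp_const (hH t), pmfExp_const_mul (hH t), roundReward_succ hfin]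
    rw [e1, e2]
    refine pmfExp_mono (hH t) fun h _ => ?_
    rw [hexp3, hexp3]
    exact exp3_step_le hP h0 h1 _ (hr (t + 1))
  have hu0 : u 0 = Real.log P.card := by
    simp only [hu, hHdef, historyLaw]
    rw [pmfExp_pure]
    simp [exp3Potential, exp3Estimate]
  have hv0 : v 0 = 0 := by
    simp only [hv, hHdef, historyLaw]
    rw [pmfExp_pure]
    rfl
  have hvsum : ∀ t, v t = ∑ s ∈ Finset.range t, r (s + 1) a := fun t => by
    induction t with
    | zero => rw [hv0, Finset.sum_range_zero]
    | succ t ih => rw [hvstep, ih, Finset.sum_range_succ]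
  have husum : ∀ t, (1 - γ) * (u t - Real.log P.card) ≤
      γ / P.card * ∑ s ∈ Finset.range t, roundReward (exp3 P T) r (s + 1) +
        t * (γ ^ 2 / P.card) := fun t => by
    induction t with
    | zero => simp [hu0]
    | succ t ih =>
      rw [Finset.sum_range_succ]
      push_cast
      linarith [hustep t]
  have huv : γ / P.card * v τ ≤ u τ := by
    simp only [hu, hv]
    rw [← pmfExp_const_mul (hH τ)]
    exact pmfExp_mono (hH τ) fun h _ => le_exp3Potential _ ha
  have hvle : v τ ≤ τ := by
    rw [hvsum]
    calc _ ≤ ∑ s ∈ Finset.range τ, (1 : ℝ) := Finset.sum_le_sum fun s _ => (hr _ _).2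
      _ = τ := by simp
  have hlogK : 0 ≤ Real.log P.card := Real.log_natCast_nonneg _
  rw [Finset.sum_sub_distrib, ← hvsum]
  set G := ∑ s ∈ Finset.range τ, roundReward (exp3 P T) r (s + 1) with hG
  have hmain : (1 - γ) * (γ / P.card * v τ - Real.log P.card) ≤
      γ / P.card * G + τ * (γ ^ 2 / P.card) :=
    (mul_le_mul_of_nonneg_left (by linarith) (by linarith)).trans (husum τ)
  have hmul := mul_le_mul_of_nonneg_left hmain (by positivity : 0 ≤ P.card / γ)
  have l1 : P.card / γ * ((1 - γ) * (γ / P.card * v τ - Real.log P.card)) =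
      (1 - γ) * v τ - (1 - γ) * (P.card * Real.log P.card / γ) := by
    field_simp
  have l2 : P.card / γ * (γ / P.card * G + τ * (γ ^ 2 / P.card)) = G + γ * τ := by
    field_simp
  rw [l1, l2] at hmul
  have hz : 0 ≤ γ * (P.card * Real.log P.card / γ) := by positivity
  nlinarith

theorem exp3_regret_le {r : ℕ → X → ℝ} (hr : ∀ t x, r t x ∈ Set.Icc (0 : ℝ) 1) {a : X}
    (ha : a ∈ P) {τ : ℕ} (hτ : τ ≤ T) (hT : 1 ≤ T) :
    ∑ s ∈ Finset.range τ, (r (s + 1) a - roundReward (exp3 P T) r (s + 1)) ≤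
      4 * √(P.card * T * Real.log P.card) := by
  have hP : P.Nonempty := ⟨a, ha⟩
  have hK : (0 : ℝ) < P.card := by exact_mod_cast hP.card_pos
  have hT0 : (0 : ℝ) < T := by exact_mod_cast hT
  have hτT : (τ : ℝ) ≤ T := by exact_mod_cast hτ
  have hlogK : 0 ≤ Real.log P.card := Real.log_natCast_nonneg _
  have he1 : 1 ≤ Real.exp 1 - 1 := by linarith [Real.add_one_le_exp (1 : ℝ)]
  have he2 : Real.exp 1 - 1 ≤ 4 := by linarith [Real.exp_one_lt_d9]
  rcases Nat.lt_or_ge 1 P.card with hcard | hcard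
  · have hlogpos : 0 < Real.log P.card := Real.log_pos (by exact_mod_cast hcard)
    set Q := √(P.card * T * Real.log P.card) with hQ
    have hQ0 : 0 < Q := Real.sqrt_pos.2 (by positivity)
    have hQ2 : Q * Q = P.card * T * Real.log P.card := Real.mul_self_sqrt (by positivity)
    set g := √(P.card * Real.log P.card / ((Real.exp 1 - 1) * T)) with hg
    have hgpos : 0 < g := Real.sqrt_pos.2 (by
      have : 0 < (Real.exp 1 - 1) * T := by positivity
      positivity)
    have hg2 : g * g = P.card * Real.log P.card / ((Real.exp 1 - 1) * T) :=
      Real.mul_self_sqrt (by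
        have : 0 < (Real.exp 1 - 1) * T := by positivity
        positivity)
    by_cases hg1 : g ≤ 1
    · have hγ : exp3Gamma P.card T = g := min_eq_right hg1
      have := exp3_regret_le_gamma hr ha (T := T) (by rw [hγ]; exact hgpos) τ
      rw [hγ] at this
      refine this.trans ?_
      have hgT : g * T ≤ Q := by
        refine nonneg_le_nonneg_of_sq_le_sq hQ0.le ?_
        rw [hQ2]
        calc g * T * (g * T) = g * g * T * T := by ring
          _ = P.card * T * Real.log P.card / (Real.exp 1 - 1) := by
              rw [hg2]
              have : Real.exp 1 - 1 ≠ 0 := by linarith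
              field_simp
          _ ≤ _ := div_le_self (by positivity) he1
      have hQg : Q ≤ 2 * (g * T) := by
        refine nonneg_le_nonneg_of_sq_le_sq (by positivity) ?_
        rw [hQ2]
        have : P.card * Real.log P.card = g * g * ((Real.exp 1 - 1) * T) := by
          rw [hg2]
          have : Real.exp 1 - 1 ≠ 0 := by linarith
          field_simp
        calc P.card * T * Real.log P.card = g * g * T * T * (Real.exp 1 - 1) := by
              linear_combination (T : ℝ) * this
          _ ≤ g * g * T * T * 4 :=
              mul_le_mul_of_nonneg_left he2 (mul_nonneg (mul_nonneg (mul_self_nonneg g) hT0.le) hT0.le)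
          _ = _ := by ring
      have hdiv : P.card * Real.log P.card / g ≤ 2 * Q := by
        rw [div_le_iff₀ hgpos]
        refine le_of_mul_le_mul_right ?_ hT0
        calc P.card * Real.log P.card * T = Q * Q := by rw [hQ2]; ring
          _ ≤ Q * (2 * (g * T)) := by gcongr
          _ = _ := by ring
      have : 2 * g * τ ≤ 2 * Q := by
        calc 2 * g * τ ≤ 2 * g * T := by gcongr
          _ ≤ 2 * Q := by linarith
      linarith
    · have hg1' := not_le.1 hg1
      have hTQ : (T : ℝ) ≤ Q := by
        refine nonneg_le_nonneg_of_sq_le_sq hQ0.le ?_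
        rw [hQ2]
        have h2 : 1 ≤ P.card * Real.log P.card / ((Real.exp 1 - 1) * T) := by
          rw [← hg2]; nlinarith
        rw [one_le_div (mul_pos (by linarith) hT0)] at h2
        nlinarith
      calc _ ≤ ∑ s ∈ Finset.range τ, (1 : ℝ) := Finset.sum_le_sum fun s _ => by
            have := roundReward_nonneg (π := exp3 P T) (fun t x => (hr t x).1) (s + 1)
            linarith [(hr (s + 1) a).2]
        _ = τ := by simp
        _ ≤ 4 * Q := by linarith
  · have hPa : P = {a} := (Finset.card_le_one_iff_subset_singleton.1 hcard).elim fun b hb => by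
      have : a = b := Finset.mem_singleton.1 (hb ha)
      subst this
      exact (Finset.subset_singleton_iff.1 hb).resolve_left hP.ne_empty
    have hfin := fun h => exp3_support_finite (T := T) hP h
    refine (Finset.sum_nonpos fun s _ => ?_).trans (by positivity)
    rw [roundReward_succ hfin, sub_nonpos]
    refine le_trans (le_of_eq (pmfExp_const (historyLaw_support_finite hfin s) _).symm)
      (pmfExp_mono (historyLaw_support_finite hfin s) fun h _ => ?_)
    refine le_trans (le_of_eq (pmfExp_const (hfin h) _).symm) (pmfExp_mono (hfin h) fun x hx => ?_)
    have hxP := exp3_support_subset hP h hx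
    rw [hPa, Finset.mem_coe, Finset.mem_singleton] at hxP
    rw [hxP]

end exp3

end ContinuumBandit

namespace ContinuumBandit

/-! ### Deterministic policies -/

section deterministic

variable {X : Type*}

/-- The history produced by a deterministic rule. -/
def detHistory (f : List (X × ℝ) → X) (r : ℕ → X → ℝ) : ℕ → List (X × ℝ)
  | 0 => []
  | t + 1 => detHistory f r t ++ [(f (detHistory f r t), r (t + 1) (f (detHistory f r t)))]

/-- The strategy that a deterministic rule plays after `t` rounds. -/
def detPlay (f : List (X × ℝ) → X) (r : ℕ → X → ℝ) (t : ℕ) : X := f (detHistory f r t)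

theorem historyLaw_pure (f : List (X × ℝ) → X) (r : ℕ → X → ℝ) (t : ℕ) :
    historyLaw (fun h => PMF.pure (f h)) r t = PMF.pure (detHistory f r t) := by
  induction t with
  | zero => rfl
  | succ t ih => rw [historyLaw, ih, PMF.pure_bind, PMF.pure_map, detHistory]

theorem roundReward_pure (f : List (X × ℝ) → X) (r : ℕ → X → ℝ) (t : ℕ) :
    roundReward (fun h => PMF.pure (f h)) r (t + 1) = r (t + 1) (detPlay f r t) := by
  rw [roundReward, playLaw, Nat.add_sub_cancel, historyLaw_pure, PMF.pure_bind,
    tsum_eq_single (f (detHistory f r t)), PMF.pure_apply_self, ENNReal.toReal_one, one_mul]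
  · rfl
  · intro x hx
    rw [PMF.pure_apply_of_ne _ _ hx, ENNReal.toReal_zero, zero_mul]

theorem length_detHistory (f : List (X × ℝ) → X) (r : ℕ → X → ℝ) (t : ℕ) :
    (detHistory f r t).length = t := by
  induction t with
  | zero => rfl
  | succ t ih => rw [detHistory, List.length_append, ih, List.length_singleton]

open scoped Classical in
/-- The sum of the rewards received from `x`. -/
noncomputable def playSum (h : List (X × ℝ)) (x : X) : ℝ :=
  ((h.filter fun q => q.1 = x).map Prod.snd).sum

open scoped Classical in
theorem playCount_append (h : List (X × ℝ)) (y : X) (ρ : ℝ) (x : X) :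
    playCount (h ++ [(y, ρ)]) x = playCount h x + if y = x then 1 else 0 := by
  unfold playCount
  rw [List.filter_append, List.length_append]
  split_ifs with hy <;> simp [hy]

open scoped Classical in
theorem playSum_append (h : List (X × ℝ)) (y : X) (ρ : ℝ) (x : X) :
    playSum (h ++ [(y, ρ)]) x = playSum h x + if y = x then ρ else 0 := by
  unfold playSum
  rw [List.filter_append, List.map_append, List.sum_append]
  split_ifs with hy <;> simp [hy]

open scoped Classical in
theorem playCount_detHistory (f : List (X × ℝ) → X) (r : ℕ → X → ℝ) (t : ℕ) (x : X) :
    playCount (detHistory f r t) x =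
      ((Finset.range t).filter fun s => detPlay f r s = x).card := by
  induction t with
  | zero => rfl
  | succ t ih =>
    rw [detHistory, playCount_append, ih, Finset.range_add_one, Finset.filter_insert]
    change _ + (if detPlay f r t = x then 1 else 0) = _
    split_ifs with h
    · rw [Finset.card_insert_of_notMem]
      simp
    · rfl

end deterministic

/-! ### UCB-1 on a sample path -/

/-- The width of the confidence intervals of UCB-1. -/
noncomputable def ucbWidth (ζ s₀ : ℝ) (t N : ℕ) : ℝ :=
  max (ζ * √(8 * Real.log t / N)) (8 * Real.log t / (s₀ * N))

section ucb

variable {X : Type*} {pick : Finset X → X} {ζ s₀ : ℝ} {P : Finset X}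

theorem ucbIndex_eq (h : List (X × ℝ)) (x : X) :
    ucbIndex ζ s₀ h x = playSum h x / playCount h x + ucbWidth ζ s₀ h.length (playCount h x) :=
  rfl

theorem ucbCandidates_subset (h : List (X × ℝ)) : ucbCandidates ζ s₀ P h ⊆ P := by
  classical
  unfold ucbCandidates
  split_ifs <;> exact Finset.filter_subset _ _

theorem mem_ucbCandidates {h : List (X × ℝ)} {x : X} :
    x ∈ ucbCandidates ζ s₀ P h ↔ x ∈ P ∧ ((playCount h x = 0) ∨
      ((∀ y ∈ P, playCount h y ≠ 0) ∧ ∀ y ∈ P, ucbIndex ζ s₀ h y ≤ ucbIndex ζ s₀ h x)) := by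
  classical
  unfold ucbCandidates
  split_ifs with hex
  · obtain ⟨z, hz, hz0⟩ := hex
    rw [Finset.mem_filter]
    constructor
    · exact fun hx => ⟨hx.1, Or.inl hx.2⟩
    · rintro ⟨hx, h0 | ⟨h1, -⟩⟩
      · exact ⟨hx, h0⟩
      · exact absurd hz0 (h1 z hz)
  · push Not at hex
    rw [Finset.mem_filter]
    constructor
    · exact fun hx => ⟨hx.1, Or.inr ⟨hex, hx.2⟩⟩
    · rintro ⟨hx, h0 | ⟨-, h1⟩⟩
      · exact absurd h0 (hex x hx)
      · exact ⟨hx, h1⟩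

theorem ucbCandidates_nonempty (hP : P.Nonempty) (h : List (X × ℝ)) :
    (ucbCandidates ζ s₀ P h).Nonempty := by
  by_cases hex : ∃ y ∈ P, playCount h y = 0
  · obtain ⟨y, hy, hy0⟩ := hex
    exact ⟨y, mem_ucbCandidates.2 ⟨hy, Or.inl hy0⟩⟩
  · push Not at hex
    obtain ⟨y, hy, hmax⟩ := P.exists_max_image (ucbIndex ζ s₀ h) hP
    exact ⟨y, mem_ucbCandidates.2 ⟨hy, Or.inr ⟨hex, hmax⟩⟩⟩

/-- The choice rule of UCB-1. -/
noncomputable def ucbRule (pick : Finset X → X) (ζ s₀ : ℝ) (P : Finset X) (h : List (X × ℝ)) : X :=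
  pick (ucbCandidates ζ s₀ P h)

theorem ucb1_eq (T : ℕ) : ucb1 pick ζ s₀ P T = fun h => PMF.pure (ucbRule pick ζ s₀ P h) := rfl

theorem ucbRule_mem_candidates (hpick : ∀ S, S.Nonempty → pick S ∈ S) (hP : P.Nonempty)
    (h : List (X × ℝ)) : ucbRule pick ζ s₀ P h ∈ ucbCandidates ζ s₀ P h :=
  hpick _ (ucbCandidates_nonempty hP h)

theorem ucbRule_mem (hpick : ∀ S, S.Nonempty → pick S ∈ S) (hP : P.Nonempty)
    (h : List (X × ℝ)) : ucbRule pick ζ s₀ P h ∈ P :=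
  ucbCandidates_subset h (ucbRule_mem_candidates hpick hP h)

/-- Some arm's empirical mean deviates from its mean by more than the width. -/
def UcbDeviates (ζ s₀ : ℝ) (P : Finset X) (m : X → ℝ) (h : List (X × ℝ)) : Prop :=
  ∃ x ∈ P, 1 ≤ playCount h x ∧
    ucbWidth ζ s₀ h.length (playCount h x) < |playSum h x / playCount h x - m x|

theorem ucbRule_gap_le (hpick : ∀ S, S.Nonempty → pick S ∈ S) {m : X → ℝ} {h : List (X × ℝ)}
    {a : X} (ha : a ∈ P) (h0 : playCount h (ucbRule pick ζ s₀ P h) ≠ 0)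
    (hdev : ¬ UcbDeviates ζ s₀ P m h) :
    m a - m (ucbRule pick ζ s₀ P h) ≤
      2 * ucbWidth ζ s₀ h.length (playCount h (ucbRule pick ζ s₀ P h)) := by
  have hmem := ucbRule_mem_candidates (ζ := ζ) (s₀ := s₀) hpick ⟨a, ha⟩ h
  set x := ucbRule pick ζ s₀ P h
  obtain ⟨hx, hx0 | ⟨hall, hmax⟩⟩ := mem_ucbCandidates.1 hmem
  · exact absurd hx0 h0
  · have hidx := hmax a ha
    rw [ucbIndex_eq, ucbIndex_eq] at hidx
    simp only [UcbDeviates, not_exists, not_and, not_lt] at hdev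
    have h1 := (abs_le.1 (hdev a ha (Nat.one_le_iff_ne_zero.2 (hall a ha)))).1
    have h2 := (abs_le.1 (hdev x hx (Nat.one_le_iff_ne_zero.2 h0))).2
    linarith

theorem ucbWidth_mul_le (hζ : 0 ≤ ζ) (hs₀ : 0 < s₀) {t T N G : ℕ} (ht : 1 ≤ t) (htT : t ≤ T)
    (hN : 1 ≤ N) (hNG : G ≤ N + 1) :
    G * ucbWidth ζ s₀ t N ≤ 4 * ζ * √(Real.log T) * √G + 16 * Real.log T / s₀ := by
  have hlog : Real.log t ≤ Real.log T :=
    Real.log_le_log (by exact_mod_cast ht) (by exact_mod_cast htT)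
  have hlog0 : 0 ≤ Real.log t := Real.log_natCast_nonneg t
  have hlogT : 0 ≤ Real.log T := Real.log_natCast_nonneg T
  have hN0 : (0 : ℝ) < N := by exact_mod_cast hN
  have hG : (G : ℝ) ≤ 2 * N := by exact_mod_cast (by omega : G ≤ 2 * N)
  have hG0 : (0 : ℝ) ≤ G := Nat.cast_nonneg G
  have h1 : G * (ζ * √(8 * Real.log t / N)) ≤ 4 * ζ * √(Real.log T) * √G := by
    have : G * √(8 * Real.log t / N) ≤ 4 * √(Real.log T) * √G := by
      rw [show (4 : ℝ) = √16 by rw [show (16 : ℝ) = 4 ^ 2 by norm_num]; simp,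
        ← Real.sqrt_mul (by norm_num), ← Real.sqrt_mul (by positivity)]
      refine Real.le_sqrt_of_sq_le ?_
      rw [mul_pow, Real.sq_sqrt (by positivity), mul_div_assoc', div_le_iff₀ hN0]
      calc (G : ℝ) ^ 2 * (8 * Real.log t) = 8 * G * Real.log t * G := by ring
        _ ≤ 8 * G * Real.log T * (2 * N) := by gcongr
        _ = _ := by ring
    calc G * (ζ * √(8 * Real.log t / N)) = ζ * (G * √(8 * Real.log t / N)) := by ring
      _ ≤ ζ * (4 * √(Real.log T) * √G) := by gcongr
      _ = _ := by ring
  have h2 : G * (8 * Real.log t / (s₀ * N)) ≤ 16 * Real.log T / s₀ := by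
    rw [mul_div_assoc', div_le_div_iff₀ (by positivity) hs₀]
    calc G * (8 * Real.log t) * s₀ ≤ (2 * N) * (8 * Real.log T) * s₀ := by gcongr
      _ = _ := by ring
  have h3 : 0 ≤ 4 * ζ * √(Real.log T) * √G := by positivity
  have h4 : 0 ≤ 16 * Real.log T / s₀ := by positivity
  unfold ucbWidth
  rw [mul_max_of_nonneg _ _ hG0]
  exact max_le (by linarith) (by linarith)

open scoped Classical in
/-- The regret of UCB-1 on a sample path, up to the rounds in which some confidence interval is
violated. -/
theorem ucb_path_regret_le (hpick : ∀ S, S.Nonempty → pick S ∈ S) (hζ : 0 ≤ ζ) (hs₀ : 0 < s₀)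
    {m : X → ℝ} {a : X} (ha : a ∈ P) {R : ℝ} (hR0 : 0 ≤ R) (hR : ∀ x ∈ P, m a - m x ≤ R)
    (r : ℕ → X → ℝ) {n T : ℕ} (hn : n ≤ T) :
    ∑ t ∈ Finset.range n, (m a - m (detPlay (ucbRule pick ζ s₀ P) r t)) ≤
      R * P.card + R * ∑ t ∈ Finset.range n,
        (if UcbDeviates ζ s₀ P m (detHistory (ucbRule pick ζ s₀ P) r t) then 1 else 0) +
      (8 * ζ * √(P.card * T * Real.log T) + 32 / s₀ * (P.card * Real.log T)) := by
  set f := ucbRule pick ζ s₀ P with hf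
  set x := detPlay f r with hx
  set H := detHistory f r with hH
  have hxP : ∀ t, x t ∈ P := fun t => ucbRule_mem hpick ⟨a, ha⟩ _
  have hlen : ∀ t, (H t).length = t := length_detHistory f r
  have hcount : ∀ t y, playCount (H t) y = ((Finset.range t).filter fun s => x s = y).card :=
    playCount_detHistory f r
  set S := (Finset.range n).filter fun t => playCount (H t) (x t) ≠ 0 ∧
    m a - m (x t) ≤ 2 * ucbWidth ζ s₀ t (playCount (H t) (x t)) with hS
  have hstep : ∀ t ∈ Finset.range n, m a - m (x t) ≤
      R * (if playCount (H t) (x t) = 0 then 1 else 0) +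
      R * (if UcbDeviates ζ s₀ P m (H t) then 1 else 0) +
      (if playCount (H t) (x t) ≠ 0 ∧
        m a - m (x t) ≤ 2 * ucbWidth ζ s₀ t (playCount (H t) (x t))
        then max (m a - m (x t)) 0 else 0) := by
    intro t _
    have hRt := hR _ (hxP t)
    have hmax : ∀ p : Prop, [Decidable p] → 0 ≤ if p then max (m a - m (x t)) 0 else 0 := by
      intro p _
      split_ifs
      · exact le_max_right _ _
      · exact le_rfl
    have hRb : ∀ p : Prop, [Decidable p] → 0 ≤ R * if p then (1 : ℝ) else 0 := by
      intro p _
      split_ifs <;> simp [hR0]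
    by_cases h0 : playCount (H t) (x t) = 0
    · rw [if_pos h0, mul_one]
      linarith [hRb (UcbDeviates ζ s₀ P m (H t)), hmax (playCount (H t) (x t) ≠ 0 ∧
        m a - m (x t) ≤ 2 * ucbWidth ζ s₀ t (playCount (H t) (x t)))]
    · by_cases hd : UcbDeviates ζ s₀ P m (H t)
      · rw [if_pos hd, mul_one]
        linarith [hRb (playCount (H t) (x t) = 0), hmax (playCount (H t) (x t) ≠ 0 ∧
          m a - m (x t) ≤ 2 * ucbWidth ζ s₀ t (playCount (H t) (x t)))]
      · have hgap := ucbRule_gap_le hpick ha h0 hd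
        rw [hlen] at hgap
        rw [if_pos (⟨h0, hgap⟩ : playCount (H t) (x t) ≠ 0 ∧
          m a - m (x t) ≤ 2 * ucbWidth ζ s₀ t (playCount (H t) (x t)))]
        linarith [hRb (playCount (H t) (x t) = 0), hRb (UcbDeviates ζ s₀ P m (H t)),
          le_max_left (m a - m (x t)) 0]
  have hfirst : ∑ t ∈ Finset.range n, (if playCount (H t) (x t) = 0 then (1 : ℝ) else 0) ≤
      P.card := by
    rw [Finset.sum_boole]
    have hinj : Set.InjOn x ((Finset.range n).filter fun t => playCount (H t) (x t) = 0) := by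
      have key : ∀ s t, s < t → playCount (H t) (x t) = 0 → x s ≠ x t := by
        intro s t hst h0 he
        rw [hcount, Finset.card_eq_zero] at h0
        have : s ∈ (∅ : Finset ℕ) := by
          rw [← h0, Finset.mem_filter]
          exact ⟨Finset.mem_range.2 hst, he⟩
        simp at this
      intro s hs t ht he
      simp only [Finset.coe_filter, Set.mem_ofPred_eq] at hs ht
      rcases lt_trichotomy s t with h | h | h
      · exact absurd he (key s t h ht.2)
      · exact h
      · exact absurd he.symm (key t s h hs.2)
    exact_mod_cast Finset.card_le_card_of_injOn x (fun t _ => hxP t) hinj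
  have hlogT : 0 ≤ Real.log T := Real.log_natCast_nonneg T
  have hthird : ∑ t ∈ S, max (m a - m (x t)) 0 ≤
      8 * ζ * √(P.card * T * Real.log T) + 32 / s₀ * (P.card * Real.log T) := by
    set G : X → ℕ := fun y => (S.filter fun t => x t = y).card with hG
    have harm : ∀ y ∈ P, ∑ t ∈ S.filter (fun t => x t = y), max (m a - m (x t)) 0 ≤
        8 * ζ * √(Real.log T) * √(G y) + 32 / s₀ * Real.log T := by
      intro y _
      have hnn : 0 ≤ 8 * ζ * √(Real.log T) * √(G y) + 32 / s₀ * Real.log T := by positivity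
      rw [Finset.sum_congr rfl (g := fun _ => max (m a - m y) 0) fun t ht => by
        rw [(Finset.mem_filter.1 ht).2], Finset.sum_const, nsmul_eq_mul]
      rcases (S.filter fun t => x t = y).eq_empty_or_nonempty with he | hne
      · rw [he]
        simpa using hnn
      · rcases le_total (m a - m y) 0 with hneg | hpos
        · rw [max_eq_right hneg, mul_zero]
          exact hnn
        · rw [max_eq_left hpos]
          set t := (S.filter fun t => x t = y).max' hne with ht
          have htmem := Finset.max'_mem _ hne
          rw [← ht, Finset.mem_filter, hS, Finset.mem_filter, Finset.mem_range] at htmem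
          obtain ⟨⟨htn, hc0, hgap⟩, hty⟩ := htmem
          rw [hty] at hc0 hgap
          have hsub : (S.filter fun t => x t = y) ⊆
              insert t ((Finset.range t).filter fun s => x s = y) := by
            intro s hs
            rcases (Finset.le_max' _ s hs).eq_or_lt with h | h
            · exact Finset.mem_insert.2 (Or.inl h)
            · exact Finset.mem_insert.2 (Or.inr (Finset.mem_filter.2
                ⟨Finset.mem_range.2 h, (Finset.mem_filter.1 hs).2⟩))
          have hGN : G y ≤ playCount (H t) y + 1 := by
            rw [hcount]
            exact (Finset.card_le_card hsub).trans (Finset.card_insert_le _ _)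
          have ht1 : 1 ≤ t := by
            by_contra h
            have : t = 0 := by omega
            rw [hcount, this] at hc0
            simp at hc0
          have := ucbWidth_mul_le hζ hs₀ ht1 (htn.le.trans hn) (Nat.one_le_iff_ne_zero.2 hc0) hGN
          calc ((S.filter fun t => x t = y).card : ℝ) * (m a - m y)
              ≤ G y * (2 * ucbWidth ζ s₀ t (playCount (H t) y)) := by gcongr
            _ = 2 * (G y * ucbWidth ζ s₀ t (playCount (H t) y)) := by ring
            _ ≤ 2 * (4 * ζ * √(Real.log T) * √(G y) + 16 * Real.log T / s₀) := by gcongr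
            _ = _ := by ring
    have hGsum : ∑ y ∈ P, (G y : ℝ) ≤ T := by
      have h1 : S.card = ∑ y ∈ P, G y := Finset.card_eq_sum_card_fiberwise fun t _ => hxP t
      have h2 : S.card ≤ n :=
        (Finset.card_filter_le _ _).trans_eq (Finset.card_range n)
      have : ∑ y ∈ P, G y ≤ T := by omega
      exact_mod_cast this
    have hsqrt : ∑ y ∈ P, √(G y : ℝ) ≤ √(P.card * T) := by
      refine Real.le_sqrt_of_sq_le (sq_sum_le_card_mul_sum_sq.trans ?_)
      simp_rw [Real.sq_sqrt (Nat.cast_nonneg _)]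
      gcongr
    rw [← Finset.sum_fiberwise_of_maps_to (s := S) (t := P) fun t _ => hxP t]
    calc _ ≤ ∑ y ∈ P, (8 * ζ * √(Real.log T) * √(G y) + 32 / s₀ * Real.log T) :=
          Finset.sum_le_sum harm
      _ = 8 * ζ * √(Real.log T) * ∑ y ∈ P, √(G y : ℝ) + 32 / s₀ * (P.card * Real.log T) := by
          rw [Finset.sum_add_distrib, ← Finset.mul_sum, Finset.sum_const, nsmul_eq_mul]
          ring
      _ ≤ 8 * ζ * √(Real.log T) * √(P.card * T) + 32 / s₀ * (P.card * Real.log T) := by gcongr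
      _ = _ := by
          rw [Real.sqrt_mul (by positivity : (0 : ℝ) ≤ P.card * T)]
          ring
  refine (Finset.sum_le_sum hstep).trans ?_
  rw [Finset.sum_add_distrib, Finset.sum_add_distrib, ← Finset.mul_sum, ← Finset.mul_sum]
  rw [hS, Finset.sum_filter] at hthird
  exact add_le_add (add_le_add_left (mul_le_mul_of_nonneg_left hfirst hR0) _) hthird

end ucb

end ContinuumBandit

namespace ContinuumBandit

section measurability

variable {X : Type*} {pick : Finset X → X} {ζ s₀ : ℝ} {P : Finset X}

theorem measurableSet_ucbRule_eq {Ω : Type*} [MeasurableSpace Ω] {h : Ω → List (X × ℝ)} {t : ℕ}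
    (hlen : ∀ ω, (h ω).length = t) (hcount : ∀ x ∈ P, Measurable fun ω => playCount (h ω) x)
    (hsum : ∀ x ∈ P, Measurable fun ω => playSum (h ω) x) (x : X) :
    MeasurableSet {ω | ucbRule pick ζ s₀ P (h ω) = x} := by
  classical
  have hidx : ∀ y ∈ P, Measurable fun ω => ucbIndex ζ s₀ (h ω) y := by
    intro y hy
    have hc : Measurable fun ω => (playCount (h ω) y : ℝ) :=
      (measurable_from_top (f := fun n : ℕ => (n : ℝ))).comp (hcount y hy)
    have hw : Measurable fun ω => ucbWidth ζ s₀ t (playCount (h ω) y) :=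
      (measurable_from_top (f := fun n : ℕ => ucbWidth ζ s₀ t n)).comp (hcount y hy)
    simp_rw [ucbIndex_eq, hlen]
    exact ((hsum y hy).div hc).add hw
  have hmem : ∀ y ∈ P, MeasurableSet {ω | y ∈ ucbCandidates ζ s₀ P (h ω)} := by
    intro y hy
    have hzero : ∀ z ∈ P, MeasurableSet {ω | playCount (h ω) z = 0} := fun z hz =>
      hcount z hz (measurableSet_singleton 0)
    have : {ω | y ∈ ucbCandidates ζ s₀ P (h ω)} = {ω | playCount (h ω) y = 0} ∪
        ((⋂ z ∈ P, {ω | playCount (h ω) z = 0}ᶜ) ∩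
          ⋂ z ∈ P, {ω | ucbIndex ζ s₀ (h ω) z ≤ ucbIndex ζ s₀ (h ω) y}) := by
      ext ω
      simp [mem_ucbCandidates, hy]
    rw [this]
    exact (hzero y hy).union ((P.measurableSet_biInter fun z hz => (hzero z hz).compl).inter
      (P.measurableSet_biInter fun z hz => measurableSet_le (hidx z hz) (hidx y hy)))
  have : {ω | ucbRule pick ζ s₀ P (h ω) = x} =
      ⋃ S ∈ P.powerset.filter (fun S => pick S = x), {ω | ucbCandidates ζ s₀ P (h ω) = S} := by
    ext ω
    simp only [ucbRule, Set.mem_ofPred_eq, Finset.mem_filter, Finset.mem_powerset, Set.mem_iUnion,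
      exists_prop]
    constructor
    · exact fun hx => ⟨_, ⟨ucbCandidates_subset _, hx⟩, rfl⟩
    · rintro ⟨S, ⟨-, hS⟩, rfl⟩
      exact hS
  rw [this]
  refine Finset.measurableSet_biUnion _ fun S hS => ?_
  have hSP : S ⊆ P := Finset.mem_powerset.1 (Finset.mem_filter.1 hS).1
  have : {ω | ucbCandidates ζ s₀ P (h ω) = S} =
      (⋂ y ∈ S, {ω | y ∈ ucbCandidates ζ s₀ P (h ω)}) ∩
        ⋂ y ∈ P \ S, {ω | y ∈ ucbCandidates ζ s₀ P (h ω)}ᶜ := by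
    ext ω
    simp only [Set.mem_ofPred_eq, Set.mem_inter_iff, Set.mem_iInter, Set.mem_compl_iff,
      Finset.mem_sdiff]
    constructor
    · rintro rfl
      exact ⟨fun y hy => hy, fun y hy => hy.2⟩
    · rintro ⟨h1, h2⟩
      refine Finset.Subset.antisymm (fun y hy => ?_) h1
      by_contra hyS
      exact h2 y ⟨ucbCandidates_subset _ hy, hyS⟩ hy
  rw [this]
  exact (S.measurableSet_biInter fun y hy => hmem y (hSP hy)).inter
    ((P \ S).measurableSet_biInter fun y hy => (hmem y (Finset.mem_sdiff.1 hy).1).compl)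

theorem measurable_playCount_playSum {Ω : Type*} [MeasurableSpace Ω] {Y : ℕ → Ω → X → ℝ} {t : ℕ}
    (hY : ∀ s < t, ∀ x ∈ P, Measurable fun ω => Y (s + 1) ω x) {s : ℕ} (hs : s ≤ t) :
    ∀ x ∈ P,
      Measurable (fun ω => playCount (detHistory (ucbRule pick ζ s₀ P) (fun u => Y u ω) s) x) ∧
      Measurable fun ω => playSum (detHistory (ucbRule pick ζ s₀ P) (fun u => Y u ω) s) x := by
  classical
  induction s with
  | zero => exact fun x _ => ⟨measurable_const, measurable_const⟩
  | succ s ih =>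
    intro x hx
    have ih := ih (by omega)
    have hset := measurableSet_ucbRule_eq (pick := pick) (ζ := ζ) (s₀ := s₀)
      (fun ω => length_detHistory (ucbRule pick ζ s₀ P) (fun u => Y u ω) s)
      (fun y hy => (ih y hy).1) (fun y hy => (ih y hy).2) x
    simp_rw [detHistory, playCount_append, playSum_append]
    refine ⟨(ih x hx).1.add (Measurable.ite hset measurable_const measurable_const),
      (ih x hx).2.add ?_⟩
    have : (fun ω => if ucbRule pick ζ s₀ P (detHistory (ucbRule pick ζ s₀ P) (fun u => Y u ω) s) = x
          then Y (s + 1) ω (ucbRule pick ζ s₀ P (detHistory (ucbRule pick ζ s₀ P) (fun u => Y u ω) s))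
          else 0) = {ω | ucbRule pick ζ s₀ P (detHistory (ucbRule pick ζ s₀ P)
            (fun u => Y u ω) s) = x}.indicator fun ω => Y (s + 1) ω x := by
      funext ω
      by_cases h : ucbRule pick ζ s₀ P (detHistory (ucbRule pick ζ s₀ P) (fun u => Y u ω) s) = x
      · rw [if_pos h, Set.indicator_of_mem (by exact h), h]
      · rw [if_neg h, Set.indicator_of_notMem (by exact h)]
    rw [this]
    exact (hY s (by omega) x hx).indicator hset

theorem measurable_exp_indicator {Ω : Type*} [MeasurableSpace Ω] {c : Ω → ℕ} {σ : Ω → ℝ}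
    (hc : Measurable c) (hσ : Measurable σ) (s a b : ℝ) {A : Set Ω} (hA : MeasurableSet A) :
    Measurable (A.indicator fun ω => ENNReal.ofReal (Real.exp (s * (σ ω - c ω * a) - c ω * b))) := by
  have hc' : Measurable fun ω => (c ω : ℝ) :=
    (measurable_from_top (f := fun n : ℕ => (n : ℝ))).comp hc
  exact (Real.measurable_exp.comp ((measurable_const.mul (hσ.sub (hc'.mul_const _))).sub
    (hc'.mul_const _))).ennreal_ofReal.indicator hA

end measurability

/-! ### UCB-1 with random rewards -/

/-- Rewards that are, in every round, independent of the past, with fixed means, and sub-Gaussian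
around them. -/
structure IsSubGaussianBandit {X Ω : Type*} [mΩ : MeasurableSpace Ω] (μ : Measure Ω) (ζ s₀ : ℝ)
    (P : Finset X) (m : X → ℝ) (ℱ : ℕ → MeasurableSpace Ω) (Y : ℕ → Ω → X → ℝ) : Prop where
  le : ∀ t, ℱ t ≤ mΩ
  measurable : ∀ t, ∀ s < t, ∀ x ∈ P, Measurable[ℱ t] fun ω => Y (s + 1) ω x
  indep : ∀ t, ∀ x ∈ P,
    Indep (ℱ t) (MeasurableSpace.comap (fun ω => Y (t + 1) ω x) inferInstance) μ
  integrable : ∀ t, ∀ x ∈ P, Integrable (fun ω => Y (t + 1) ω x) μ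
  integral_eq : ∀ t, ∀ x ∈ P, ∫ ω, Y (t + 1) ω x ∂μ = m x
  lintegral_exp_le : ∀ t, ∀ x ∈ P, ∀ s ∈ Set.Icc (-s₀) s₀,
    ∫⁻ ω, ENNReal.ofReal (Real.exp (s * (Y (t + 1) ω x - m x))) ∂μ ≤
      ENNReal.ofReal (Real.exp (1 / 2 * ζ ^ 2 * s ^ 2))

namespace IsSubGaussianBandit

variable {X Ω : Type*} [mΩ : MeasurableSpace Ω] {μ : Measure Ω}
  {pick : Finset X → X} {ζ s₀ : ℝ} {P : Finset X} {m : X → ℝ} {ℱ : ℕ → MeasurableSpace Ω}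
  {Y : ℕ → Ω → X → ℝ}

theorem measurable_reward (hY : IsSubGaussianBandit μ ζ s₀ P m ℱ Y) (t : ℕ) {x : X} (hx : x ∈ P) :
    Measurable fun ω => Y (t + 1) ω x :=
  (hY.measurable (t + 1) t t.lt_succ_self x hx).mono (hY.le _) le_rfl

theorem measurableSet_play (hY : IsSubGaussianBandit μ ζ s₀ P m ℱ Y) (t : ℕ) (x : X) :
    MeasurableSet[ℱ t] {ω | detPlay (ucbRule pick ζ s₀ P) (fun u => Y u ω) t = x} := by
  have := @measurable_playCount_playSum X pick ζ s₀ P Ω (ℱ t) Y t (hY.measurable t) t le_rfl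
  exact @measurableSet_ucbRule_eq X pick ζ s₀ P Ω (ℱ t) _ t
    (fun ω => length_detHistory (ucbRule pick ζ s₀ P) (fun u => Y u ω) t)
    (fun y hy => (this y hy).1) (fun y hy => (this y hy).2) x

/-- The exponential supermartingale of the rewards received from one arm. -/
theorem lintegral_exp_playSum_le [IsProbabilityMeasure μ]
    (hY : IsSubGaussianBandit μ ζ s₀ P m ℱ Y) {x : X} (hx : x ∈ P)
    {s : ℝ} (hs : s ∈ Set.Icc (-s₀) s₀) (t : ℕ) :
    ∫⁻ ω, ENNReal.ofReal (Real.exp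
      (s * (playSum (detHistory (ucbRule pick ζ s₀ P) (fun u => Y u ω) t) x -
        playCount (detHistory (ucbRule pick ζ s₀ P) (fun u => Y u ω) t) x * m x) -
        playCount (detHistory (ucbRule pick ζ s₀ P) (fun u => Y u ω) t) x *
          (1 / 2 * ζ ^ 2 * s ^ 2))) ∂μ ≤ 1 := by
  classical
  induction t with
  | zero => simp [detHistory, playSum, playCount]
  | succ t ih =>
    set f := ucbRule pick ζ s₀ P
    set H := fun t ω => detHistory f (fun u => Y u ω) t
    set W : Ω → ENNReal := fun ω => ENNReal.ofReal (Real.exp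
      (s * (playSum (H t ω) x - playCount (H t ω) x * m x) -
        playCount (H t ω) x * (1 / 2 * ζ ^ 2 * s ^ 2))) with hW
    set A := {ω | detPlay f (fun u => Y u ω) t = x}
    set V : Ω → ENNReal := fun ω => ENNReal.ofReal (Real.exp
      (s * (Y (t + 1) ω x - m x) - 1 / 2 * ζ ^ 2 * s ^ 2)) with hV
    have hA : MeasurableSet[ℱ t] A := hY.measurableSet_play t x
    have hVm : Measurable[MeasurableSpace.comap (fun ω => Y (t + 1) ω x) inferInstance] V := by
      have : Measurable fun y : ℝ => ENNReal.ofReal (Real.exp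
          (s * (y - m x) - 1 / 2 * ζ ^ 2 * s ^ 2)) := by fun_prop
      exact this.comp (comap_measurable _)
    have hV1 : ∫⁻ ω, V ω ∂μ ≤ 1 := by
      have e1 : ∀ ω, V ω = ENNReal.ofReal (Real.exp (s * (Y (t + 1) ω x - m x))) *
          ENNReal.ofReal (Real.exp (-(1 / 2 * ζ ^ 2 * s ^ 2))) := fun ω => by
        rw [← ENNReal.ofReal_mul (Real.exp_pos _).le, ← Real.exp_add, ← sub_eq_add_neg]
      simp_rw [e1]
      rw [lintegral_mul_const' _ _ ENNReal.ofReal_ne_top]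
      calc _ ≤ ENNReal.ofReal (Real.exp (1 / 2 * ζ ^ 2 * s ^ 2)) *
            ENNReal.ofReal (Real.exp (-(1 / 2 * ζ ^ 2 * s ^ 2))) := by
            gcongr
            exact hY.lintegral_exp_le t x hx s hs
        _ = 1 := by
            rw [← ENNReal.ofReal_mul (Real.exp_pos _).le, ← Real.exp_add, add_neg_cancel,
              Real.exp_zero, ENNReal.ofReal_one]
    have hAm : MeasurableSet A := hY.le t _ hA
    obtain ⟨hc, hσ⟩ := @measurable_playCount_playSum X pick ζ s₀ P Ω (ℱ t) Y t (hY.measurable t) t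
      le_rfl x hx
    have hAW : ∀ B, MeasurableSet[ℱ t] B → Measurable[ℱ t] (B.indicator W) := fun B hB =>
      @measurable_exp_indicator Ω (ℱ t) _ _ hc hσ s (m x) (1 / 2 * ζ ^ 2 * s ^ 2) B hB
    have hsplit : ∀ ω, ENNReal.ofReal (Real.exp
        (s * (playSum (H (t + 1) ω) x - playCount (H (t + 1) ω) x * m x) -
          playCount (H (t + 1) ω) x * (1 / 2 * ζ ^ 2 * s ^ 2))) =
        Aᶜ.indicator W ω + A.indicator W ω * V ω := by
      intro ω
      simp only [H, detHistory, playSum_append, playCount_append]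
      by_cases hω : ω ∈ A
      · have hω' : f (detHistory f (fun u => Y u ω) t) = x := hω
        rw [Set.indicator_of_mem hω, Set.indicator_of_notMem (Set.notMem_compl_iff.2 hω), zero_add,
          if_pos hω', if_pos hω', hW, hV, ← ENNReal.ofReal_mul (Real.exp_pos _).le, ← Real.exp_add,
          hω']
        congr 2
        push_cast
        ring
      · have hω' : ¬ f (detHistory f (fun u => Y u ω) t) = x := hω
        rw [Set.indicator_of_notMem hω, Set.indicator_of_mem (Set.mem_compl hω), zero_mul,
          if_neg hω', if_neg hω', add_zero, add_zero, add_zero]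
    change ∫⁻ ω, ENNReal.ofReal (Real.exp
        (s * (playSum (H (t + 1) ω) x - playCount (H (t + 1) ω) x * m x) -
          playCount (H (t + 1) ω) x * (1 / 2 * ζ ^ 2 * s ^ 2))) ∂μ ≤ 1
    simp_rw [hsplit]
    rw [lintegral_add_left ((hAW _ (@MeasurableSet.compl _ _ (ℱ t) hA)).mono (hY.le t) le_rfl),
      lintegral_mul_eq_lintegral_mul_lintegral_of_independent_measurableSpace (hY.le t)
        (hY.measurable_reward t hx).comap_le (hY.indep t x hx) (hAW _ hA) hVm]
    calc _ ≤ ∫⁻ ω, Aᶜ.indicator W ω ∂μ + (∫⁻ ω, A.indicator W ω ∂μ) * 1 := by gcongr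
      _ = ∫⁻ ω, W ω ∂μ := by
          rw [mul_one, lintegral_indicator hAm.compl, lintegral_indicator hAm, add_comm,
            lintegral_add_compl _ hAm]
      _ ≤ 1 := ih

end IsSubGaussianBandit

end ContinuumBandit

namespace ContinuumBandit

/-- The optimal exponent in the exponential tail bound for the width of UCB-1. -/
theorem exists_exponent {ζ s₀ : ℝ} (hζ : 0 < ζ) (hs₀ : 0 < s₀) {t N : ℕ} (hN : 1 ≤ N) :
    ∃ s ∈ Set.Icc 0 s₀, 4 * Real.log t ≤ N * (s * ucbWidth ζ s₀ t N - 1 / 2 * ζ ^ 2 * s ^ 2) := by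
  have hN0 : (0 : ℝ) < N := by exact_mod_cast hN
  have hl : 0 ≤ Real.log t := Real.log_natCast_nonneg t
  have hb1 : ζ * √(8 * Real.log t / N) ≤ ucbWidth ζ s₀ t N := le_max_left _ _
  have hb2 : 8 * Real.log t / (s₀ * N) ≤ ucbWidth ζ s₀ t N := le_max_right _ _
  set b := ucbWidth ζ s₀ t N
  have hb0 : 0 ≤ b := le_trans (by positivity) hb1
  by_cases hcase : b ≤ s₀ * ζ ^ 2
  · refine ⟨b / ζ ^ 2, ⟨by positivity, by rwa [div_le_iff₀ (by positivity)]⟩, ?_⟩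
    have hsq : ζ ^ 2 * (8 * Real.log t / N) ≤ b ^ 2 := by
      have := pow_le_pow_left₀ (by positivity) hb1 2
      rwa [mul_pow, Real.sq_sqrt (by positivity)] at this
    rw [mul_div_assoc', div_le_iff₀ hN0] at hsq
    have : N * (b / ζ ^ 2 * b - 1 / 2 * ζ ^ 2 * (b / ζ ^ 2) ^ 2) = b ^ 2 * N / (2 * ζ ^ 2) := by
      field_simp
      ring
    rw [this, le_div_iff₀ (by positivity)]
    linarith
  · refine ⟨s₀, ⟨hs₀.le, le_rfl⟩, ?_⟩
    have hc := not_le.1 hcase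
    rw [div_le_iff₀ (by positivity)] at hb2
    have : N * s₀ * (s₀ * ζ ^ 2) ≤ N * s₀ * b := by gcongr
    nlinarith

theorem sum_inv_sq_le (n : ℕ) : ∑ t ∈ Finset.range n, (((t : ℝ) + 1) ^ 2)⁻¹ ≤ (2 : ℝ) := by
  have : ∀ n : ℕ, ∑ t ∈ Finset.range n, (((t : ℝ) + 1) ^ 2)⁻¹ ≤ (2 : ℝ) - 2 / (n + 1) := by
    intro n
    induction n with
    | zero => norm_num
    | succ n ih =>
      rw [Finset.sum_range_succ]
      have : (((n : ℝ) + 1) ^ 2)⁻¹ ≤ 2 / (n + 1) - 2 / ((n : ℝ) + 1 + 1) := by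
        rw [div_sub_div _ _ (by positivity) (by positivity), inv_eq_one_div,
          div_le_div_iff₀ (by positivity) (by positivity)]
        nlinarith [(Nat.cast_nonneg n : (0 : ℝ) ≤ n)]
      push_cast
      linarith
  refine (this n).trans ?_
  have : 0 ≤ 2 / ((n : ℝ) + 1) := by positivity
  linarith

/-- A function of the strategy played, as a finite sum of indicators. -/
theorem play_eq_sum_indicator {X Ω : Type*} {pick : Finset X → X} {ζ s₀ : ℝ} {P : Finset X}
    {Y : ℕ → Ω → X → ℝ} (hpick : ∀ S, S.Nonempty → pick S ∈ S) (hP : P.Nonempty)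
    (F : Ω → X → ℝ) (t : ℕ) (ω : Ω) :
    F ω (detPlay (ucbRule pick ζ s₀ P) (fun u => Y u ω) t) = ∑ x ∈ P,
      {ω | detPlay (ucbRule pick ζ s₀ P) (fun u => Y u ω) t = x}.indicator (fun ω => F ω x) ω := by
  rw [Finset.sum_eq_single_of_mem _ (ucbRule_mem hpick hP
    (detHistory (ucbRule pick ζ s₀ P) (fun u => Y u ω) t))]
  · rw [Set.indicator_of_mem]
    · rfl
    · rfl
  · intro y _ hy
    exact Set.indicator_of_notMem (fun h => hy (Eq.symm h)) _

namespace IsSubGaussianBandit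

variable {X Ω : Type*} [mΩ : MeasurableSpace Ω] {μ : Measure Ω}
  {pick : Finset X → X} {ζ s₀ : ℝ} {P : Finset X} {m : X → ℝ} {ℱ : ℕ → MeasurableSpace Ω}
  {Y : ℕ → Ω → X → ℝ}

theorem measurable_count_sum (hY : IsSubGaussianBandit μ ζ s₀ P m ℱ Y) (t : ℕ) {x : X}
    (hx : x ∈ P) :
    Measurable (fun ω => playCount (detHistory (ucbRule pick ζ s₀ P) (fun u => Y u ω) t) x) ∧
      Measurable fun ω => playSum (detHistory (ucbRule pick ζ s₀ P) (fun u => Y u ω) t) x :=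
  measurable_playCount_playSum (t := t) (fun s _ _ hx => hY.measurable_reward s hx) le_rfl x hx

/-- One-sided deviations; the sign of `s` selects the side. -/
theorem measure_deviation_le [IsProbabilityMeasure μ]
    (hY : IsSubGaussianBandit μ ζ s₀ P m ℱ Y) {x : X} (hx : x ∈ P)
    {s b : ℝ} (hs : s ∈ Set.Icc (-s₀) s₀) {t N : ℕ} (ht : 1 ≤ t)
    (hb : 4 * Real.log t ≤ N * (b - 1 / 2 * ζ ^ 2 * s ^ 2)) :
    μ {ω | playCount (detHistory (ucbRule pick ζ s₀ P) (fun u => Y u ω) t) x = N ∧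
      N * b ≤ s * (playSum (detHistory (ucbRule pick ζ s₀ P) (fun u => Y u ω) t) x - N * m x)} ≤
      ENNReal.ofReal ((t : ℝ) ^ 4)⁻¹ := by
  have ht0 : (0 : ℝ) < t := by exact_mod_cast ht
  obtain ⟨hc, hσ⟩ := hY.measurable_count_sum (pick := pick) t hx
  have hmeas := measurable_exp_indicator hc hσ s (m x) (1 / 2 * ζ ^ 2 * s ^ 2) MeasurableSet.univ
  rw [Set.indicator_univ] at hmeas
  have hmarkov := mul_meas_ge_le_lintegral (μ := μ) hmeas (ENNReal.ofReal ((t : ℝ) ^ 4))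
  have hle := hmarkov.trans (hY.lintegral_exp_playSum_le hx hs t)
  rw [mul_comm] at hle
  rw [ENNReal.ofReal_inv_of_pos (by positivity), ← one_div]
  refine (measure_mono ?_).trans (ENNReal.le_div_iff_mul_le
    (Or.inl (by simp; omega)) (Or.inl ENNReal.ofReal_ne_top) |>.2 hle)
  rintro ω ⟨hN, hω⟩
  refine ENNReal.ofReal_le_ofReal ?_
  rw [hN, ← Real.log_le_iff_le_exp (by positivity), Real.log_pow]
  push_cast
  linarith

open scoped Classical in
theorem measure_ucbDeviates_le [IsProbabilityMeasure μ]
    (hY : IsSubGaussianBandit μ ζ s₀ P m ℱ Y) (hζ : 0 < ζ)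
    (hs₀ : 0 < s₀) {t : ℕ} (ht : 1 ≤ t) :
    μ {ω | UcbDeviates ζ s₀ P m (detHistory (ucbRule pick ζ s₀ P) (fun u => Y u ω) t)} ≤
      ENNReal.ofReal (2 * P.card * ((t : ℝ) ^ 2)⁻¹) := by
  have ht0 : (0 : ℝ) < t := by exact_mod_cast ht
  set H := fun ω => detHistory (ucbRule pick ζ s₀ P) (fun u => Y u ω) t
  choose! s hs hsb using fun N : ℕ => fun hN : 1 ≤ N => exists_exponent (t := t) hζ hs₀ hN
  have hsub : {ω | UcbDeviates ζ s₀ P m (H ω)} ⊆ ⋃ x ∈ P, ⋃ N ∈ Finset.Icc 1 t,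
      ({ω | playCount (H ω) x = N ∧
        N * (s N * ucbWidth ζ s₀ t N) ≤ s N * (playSum (H ω) x - N * m x)} ∪
      {ω | playCount (H ω) x = N ∧
        N * (s N * ucbWidth ζ s₀ t N) ≤ -s N * (playSum (H ω) x - N * m x)}) := by
    rintro ω ⟨x, hx, hN, hdev⟩
    rw [length_detHistory] at hdev
    have hNt : playCount (H ω) x ≤ t := by
      have := (playCount_detHistory (ucbRule pick ζ s₀ P) (fun u => Y u ω) t x).trans_le
        (Finset.card_filter_le _ _)
      rwa [Finset.card_range] at this
    simp only [Set.mem_iUnion]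
    refine ⟨x, hx, playCount (H ω) x, Finset.mem_Icc.2 ⟨hN, hNt⟩, ?_⟩
    change ucbWidth ζ s₀ t (playCount (H ω) x) < |playSum (H ω) x / playCount (H ω) x - m x| at hdev
    set N := playCount (H ω) x with hNdef
    have hN0 : (0 : ℝ) < N := by exact_mod_cast hN
    have hsN := (hs N hN).1
    have hfac : N * (playSum (H ω) x / N - m x) = playSum (H ω) x - N * m x := by field_simp
    rcases lt_abs.1 hdev with h | h
    · left
      refine ⟨rfl, ?_⟩
      rw [← hfac, mul_left_comm]
      gcongr
    · right
      refine ⟨rfl, ?_⟩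
      calc N * (s N * ucbWidth ζ s₀ t N)
          ≤ N * (s N * -(playSum (H ω) x / N - m x)) := by gcongr
        _ = -s N * (N * (playSum (H ω) x / N - m x)) := by ring
        _ = _ := by rw [hfac]
  have hone : ∀ x ∈ P, ∀ N ∈ Finset.Icc 1 t, μ ({ω | playCount (H ω) x = N ∧
        N * (s N * ucbWidth ζ s₀ t N) ≤ s N * (playSum (H ω) x - N * m x)} ∪
      {ω | playCount (H ω) x = N ∧
        N * (s N * ucbWidth ζ s₀ t N) ≤ -s N * (playSum (H ω) x - N * m x)}) ≤
      ENNReal.ofReal (2 * ((t : ℝ) ^ 4)⁻¹) := by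
    intro x hx N hN
    have hN1 := (Finset.mem_Icc.1 hN).1
    obtain ⟨h0, h1⟩ := hs N hN1
    have hb := hsb N hN1
    rw [two_mul, ENNReal.ofReal_add (by positivity) (by positivity)]
    refine (measure_union_le _ _).trans (add_le_add ?_ ?_)
    · exact hY.measure_deviation_le hx ⟨by linarith, h1⟩ ht hb
    · exact hY.measure_deviation_le hx ⟨by linarith, by linarith⟩ ht (by rwa [neg_sq])
  calc μ {ω | UcbDeviates ζ s₀ P m (H ω)}
      ≤ ∑ x ∈ P, ∑ N ∈ Finset.Icc 1 t, ENNReal.ofReal (2 * ((t : ℝ) ^ 4)⁻¹) :=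
        (measure_mono hsub).trans ((measure_biUnion_finset_le _ _).trans
          (Finset.sum_le_sum fun x hx => (measure_biUnion_finset_le _ _).trans
            (Finset.sum_le_sum fun N hN => hone x hx N hN)))
    _ = ENNReal.ofReal (P.card * (t * (2 * ((t : ℝ) ^ 4)⁻¹))) := by
        rw [Finset.sum_const, Finset.sum_const, Nat.card_Icc, Nat.add_sub_cancel, nsmul_eq_mul,
          nsmul_eq_mul, ENNReal.ofReal_mul (Nat.cast_nonneg _), ENNReal.ofReal_natCast,
          ENNReal.ofReal_mul (Nat.cast_nonneg _), ENNReal.ofReal_natCast]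
    _ ≤ _ := by
        refine ENNReal.ofReal_le_ofReal ?_
        have h1 : (t : ℝ) * (2 * ((t : ℝ) ^ 4)⁻¹) ≤ 2 * ((t : ℝ) ^ 2)⁻¹ := by
          have : (t : ℝ) * (2 * ((t : ℝ) ^ 4)⁻¹) = 2 * ((t : ℝ) ^ 3)⁻¹ := by field_simp
          rw [this]
          have ht1 : (1 : ℝ) ≤ t := by exact_mod_cast ht
          gcongr
          norm_num
        calc _ ≤ P.card * (2 * ((t : ℝ) ^ 2)⁻¹) := by gcongr
          _ = _ := by ring

theorem measurableSet_play' (hY : IsSubGaussianBandit μ ζ s₀ P m ℱ Y) (t : ℕ) (x : X) :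
    MeasurableSet {ω | detPlay (ucbRule pick ζ s₀ P) (fun u => Y u ω) t = x} :=
  hY.le t _ (hY.measurableSet_play t x)

theorem integrable_play (hY : IsSubGaussianBandit μ ζ s₀ P m ℱ Y)
    (hpick : ∀ S, S.Nonempty → pick S ∈ S) (hP : P.Nonempty) {F : Ω → X → ℝ}
    (hF : ∀ x ∈ P, Integrable (fun ω => F ω x) μ) (t : ℕ) :
    Integrable (fun ω => F ω (detPlay (ucbRule pick ζ s₀ P) (fun u => Y u ω) t)) μ := by
  simp_rw [play_eq_sum_indicator (Y := Y) (ζ := ζ) (s₀ := s₀) hpick hP F t]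
  exact integrable_finsetSum _ fun x hx => (hF x hx).indicator (hY.measurableSet_play' t x)

theorem integral_reward [IsProbabilityMeasure μ] (hY : IsSubGaussianBandit μ ζ s₀ P m ℱ Y)
    (hpick : ∀ S, S.Nonempty → pick S ∈ S) (hP : P.Nonempty) (t : ℕ) :
    ∫ ω, Y (t + 1) ω (detPlay (ucbRule pick ζ s₀ P) (fun u => Y u ω) t) ∂μ =
      ∫ ω, m (detPlay (ucbRule pick ζ s₀ P) (fun u => Y u ω) t) ∂μ := by
  simp_rw [play_eq_sum_indicator (Y := Y) (ζ := ζ) (s₀ := s₀) hpick hP (Y (t + 1)) t,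
    play_eq_sum_indicator (Y := Y) (ζ := ζ) (s₀ := s₀) hpick hP (fun _ => m) t]
  rw [integral_finsetSum _ fun x hx => (hY.integrable t x hx).indicator (hY.measurableSet_play' t x),
    integral_finsetSum _ fun x _ => (integrable_const (m x)).indicator (hY.measurableSet_play' t x)]
  refine Finset.sum_congr rfl fun x hx => ?_
  set A := {ω | detPlay (ucbRule pick ζ s₀ P) (fun u => Y u ω) t = x}
  have hA : MeasurableSet[ℱ t] A := hY.measurableSet_play t x
  have hA' : MeasurableSet A := hY.measurableSet_play' t x
  have hind : IndepFun (A.indicator fun _ => (1 : ℝ)) (fun ω => Y (t + 1) ω x) μ := by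
    rw [IndepFun_iff_Indep]
    refine indep_of_indep_of_le_left (hY.indep t x hx) (Measurable.comap_le ?_)
    exact (@measurable_const _ _ _ (ℱ t) (1 : ℝ)).indicator hA
  have hmul := hind.integral_fun_mul_eq_mul_integral
    (measurable_const.indicator hA').aestronglyMeasurable
    (hY.measurable_reward t hx).aestronglyMeasurable
  have e1 : ∀ ω, A.indicator (fun ω => Y (t + 1) ω x) ω =
      A.indicator (fun _ => (1 : ℝ)) ω * Y (t + 1) ω x := fun ω => by
    by_cases hω : ω ∈ A <;> simp [hω]
  simp_rw [e1]
  rw [hmul, hY.integral_eq t x hx, integral_indicator_const _ hA', integral_indicator_const _ hA']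
  simp

/-- The expected regret of UCB-1. -/
theorem ucb_regret_le [IsProbabilityMeasure μ] (hY : IsSubGaussianBandit μ ζ s₀ P m ℱ Y)
    (hpick : ∀ S, S.Nonempty → pick S ∈ S) (hζ : 0 < ζ) (hs₀ : 0 < s₀)
    {a : X} (ha : a ∈ P) {R : ℝ} (hR0 : 0 ≤ R) (hR : ∀ x ∈ P, m a - m x ≤ R)
    {n T : ℕ} (hn : n ≤ T) :
    ∑ t ∈ Finset.range n,
        (m a - ∫ ω, m (detPlay (ucbRule pick ζ s₀ P) (fun u => Y u ω) t) ∂μ) ≤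
      5 * R * P.card +
        (8 * ζ * √(P.card * T * Real.log T) + 32 / s₀ * (P.card * Real.log T)) := by
  classical
  have hP : P.Nonempty := ⟨a, ha⟩
  set H := fun t ω => detHistory (ucbRule pick ζ s₀ P) (fun u => Y u ω) t
  set D := fun t => {ω | UcbDeviates ζ s₀ P m (H t ω)}
  set c := 8 * ζ * √(P.card * T * Real.log T) + 32 / s₀ * (P.card * Real.log T)
  set E := fun t => toMeasurable μ (D t)
  have hint : ∀ t, Integrable
      (fun ω => m a - m (detPlay (ucbRule pick ζ s₀ P) (fun u => Y u ω) t)) μ := fun t =>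
    hY.integrable_play hpick hP (F := fun _ x => m a - m x) (fun x _ => integrable_const _) t
  have hEint : ∀ t, Integrable ((E t).indicator fun _ => (1 : ℝ)) μ := fun t =>
    (integrable_const 1).indicator (measurableSet_toMeasurable _ _)
  have hE : ∀ t, ∫ ω, (E (t + 1)).indicator (fun _ => (1 : ℝ)) ω ∂μ ≤
      2 * P.card * (((t : ℝ) + 1) ^ 2)⁻¹ := by
    intro t
    rw [integral_indicator_const _ (measurableSet_toMeasurable _ _), smul_eq_mul, mul_one,
      measureReal_def, measure_toMeasurable]
    refine ENNReal.toReal_le_of_le_ofReal (by positivity) ?_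
    have := hY.measure_ucbDeviates_le (pick := pick) hζ hs₀ (t := t + 1) (by omega)
    push_cast at this
    exact this
  have hE0 : ∫ ω, (E 0).indicator (fun _ => (1 : ℝ)) ω ∂μ = 0 := by
    have hD0 : D 0 = ∅ := by
      ext ω
      simp only [D, H, detHistory, Set.mem_ofPred_eq, Set.mem_empty_iff_false, iff_false]
      rintro ⟨x, -, hx, -⟩
      simp [playCount] at hx
    rw [integral_indicator_const _ (measurableSet_toMeasurable _ _), smul_eq_mul, mul_one,
      measureReal_def, measure_toMeasurable, hD0, measure_empty, ENNReal.toReal_zero]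
  have hEsum : ∑ t ∈ Finset.range n, ∫ ω, (E t).indicator (fun _ => (1 : ℝ)) ω ∂μ ≤
      4 * P.card := by
    rcases n with _ | n
    · simp
    · rw [Finset.sum_range_succ', hE0, add_zero]
      calc _ ≤ ∑ t ∈ Finset.range n, 2 * (P.card : ℝ) * (((t : ℝ) + 1) ^ 2)⁻¹ :=
            Finset.sum_le_sum fun t _ => hE t
        _ = 2 * (P.card : ℝ) * ∑ t ∈ Finset.range n, (((t : ℝ) + 1) ^ 2)⁻¹ := (Finset.mul_sum _ _ _).symm
        _ ≤ 2 * P.card * 2 := by gcongr; exact sum_inv_sq_le n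
        _ = _ := by ring
  have hpath : ∀ ω, ∑ t ∈ Finset.range n,
      (m a - m (detPlay (ucbRule pick ζ s₀ P) (fun u => Y u ω) t)) ≤
      R * P.card + R * ∑ t ∈ Finset.range n, (E t).indicator (fun _ => (1 : ℝ)) ω + c := by
    intro ω
    refine (ucb_path_regret_le hpick hζ.le hs₀ ha hR0 hR (fun u => Y u ω) hn).trans ?_
    refine add_le_add_left (add_le_add_right (mul_le_mul_of_nonneg_left
      (Finset.sum_le_sum fun t _ => ?_) hR0) _) _
    split_ifs with h
    · rw [Set.indicator_of_mem (subset_toMeasurable μ (D t) h)]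
    · exact Set.indicator_nonneg (fun _ _ => zero_le_one) _
  have e1 : ∀ t, m a - ∫ ω, m (detPlay (ucbRule pick ζ s₀ P) (fun u => Y u ω) t) ∂μ =
      ∫ ω, (m a - m (detPlay (ucbRule pick ζ s₀ P) (fun u => Y u ω) t)) ∂μ := fun t => by
    rw [integral_sub (integrable_const _)
      (hY.integrable_play hpick hP (F := fun _ x => m x) (fun x _ => integrable_const _) t)]
    simp
  have hEsumint : Integrable
      (fun ω => R * ∑ t ∈ Finset.range n, (E t).indicator (fun _ => (1 : ℝ)) ω) μ :=
    (integrable_finsetSum _ fun t _ => hEint t).const_mul R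
  have hmainint : Integrable (fun ω => R * P.card +
      R * ∑ t ∈ Finset.range n, (E t).indicator (fun _ => (1 : ℝ)) ω) μ :=
    (integrable_const _).add hEsumint
  simp_rw [e1]
  rw [← integral_finsetSum _ fun t _ => hint t]
  calc _ ≤ ∫ ω, (R * P.card + R * ∑ t ∈ Finset.range n,
        (E t).indicator (fun _ => (1 : ℝ)) ω + c) ∂μ :=
        integral_mono (integrable_finsetSum _ fun t _ => hint t)
          (hmainint.add (integrable_const _)) hpath
    _ = R * P.card + R * ∑ t ∈ Finset.range n, ∫ ω, (E t).indicator (fun _ => (1 : ℝ)) ω ∂μ + c := by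
        rw [integral_add hmainint (integrable_const _),
          integral_add (integrable_const _) hEsumint, integral_const, integral_const,
          integral_const_mul, integral_finsetSum _ fun t _ => hEint t]
        simp
    _ ≤ R * P.card + R * (4 * P.card) + c := by gcongr
    _ = _ := by ring

end IsSubGaussianBandit

end ContinuumBandit

namespace ContinuumBandit

/-! ### The epochs of the algorithm -/

theorem card_strategySet_le_armBound {α : ℝ} {d k T : ℕ} (A : PartitionFamily d k) :
    ((strategySet A (gridSize α d k T)).card : ℝ) ≤ armBound α d k T := by
  unfold armBound
  exact_mod_cast card_strategySet_le A

theorem add_sqrt_le_epochBound {α L c R : ℝ} {d k T K : ℕ} (hc : 4 ≤ c) (hR : 0 ≤ R)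
    (hK : 1 ≤ K) (hKa : (K : ℝ) ≤ armBound α d k T) :
    T * (L * (√k / gridSize α d k T) ^ α) + 4 * √(K * T * Real.log K) ≤
      epochBound α L c R d k T := by
  have hK0 : (0 : ℝ) < K := by exact_mod_cast hK
  have hlT := Real.log_natCast_nonneg T
  have hlK := Real.log_natCast_nonneg K
  have hlog : Real.log K ≤ Real.log (armBound α d k T) := Real.log_le_log hK0 hKa
  have hA0 : 0 ≤ armBound α d k T := hK0.le.trans hKa
  unfold epochBound
  gcongr
  refine le_add_of_le_of_nonneg ?_ (by positivity)
  gcongr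
  linarith

theorem add_ucb_le_epochBound {α L c R ζ s₀ : ℝ} {d k T K : ℕ} (hζ : 0 ≤ ζ) (hs₀ : 0 < s₀)
    (hc : 8 * ζ + 32 / s₀ + 5 ≤ c) (hR : 1 ≤ R) (hK : 1 ≤ K)
    (hKa : (K : ℝ) ≤ armBound α d k T) :
    T * (L * (√k / gridSize α d k T) ^ α) + (5 * R * K +
        (8 * ζ * √(K * T * Real.log T) + 32 / s₀ * (K * Real.log T))) ≤
      epochBound α L c R d k T := by
  have hK1 : (1 : ℝ) ≤ K := by exact_mod_cast hK
  have hlT := Real.log_natCast_nonneg T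
  have hA1 : 1 ≤ armBound α d k T := hK1.trans hKa
  have hlA : 0 ≤ Real.log (armBound α d k T) := Real.log_nonneg hA1
  have hc0 : 0 ≤ 32 / s₀ := by positivity
  have h1 : √(K * T * Real.log T) ≤
      √(armBound α d k T * T * (Real.log T + Real.log (armBound α d k T))) := by
    gcongr
    linarith
  have h2 : R * (K : ℝ) ≤ R * armBound α d k T * (1 + Real.log T) := by
    calc R * (K : ℝ) = R * K * 1 := (mul_one _).symm
      _ ≤ R * armBound α d k T * (1 + Real.log T) := by gcongr; linarith
  have h3 : K * Real.log T ≤ R * armBound α d k T * (1 + Real.log T) := by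
    calc K * Real.log T = 1 * K * Real.log T := by ring
      _ ≤ R * armBound α d k T * (1 + Real.log T) := by gcongr; linarith
  unfold epochBound
  set Q := √(armBound α d k T * T * (Real.log T + Real.log (armBound α d k T)))
  set V := R * armBound α d k T * (1 + Real.log T)
  have hQ : 0 ≤ Q := Real.sqrt_nonneg _
  have hV : 0 ≤ V := le_trans (by positivity) h2
  have e1 : 8 * ζ * √(K * T * Real.log T) ≤ 8 * ζ * Q := by gcongr
  have e2 : 32 / s₀ * (K * Real.log T) ≤ 32 / s₀ * V := by gcongr
  have e3 : (8 * ζ + 32 / s₀ + 5) * (Q + V) ≤ c * (Q + V) := by gcongr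
  have e4 : 0 ≤ 8 * ζ * V := by positivity
  have e5 : 0 ≤ 32 / s₀ * Q := by positivity
  linarith

section adversarial

variable {α L δ : ℝ} {d k : ℕ} {g : ℕ → Cube k → ℝ} {i : Fin k ↪ Fin d} {A : PartitionFamily d k}

theorem IsAdversarialModel.exists_optimal (hα : 0 < α) (hδ : 0 < δ)
    (hg : IsAdversarialModel α L δ g) (i : Fin k ↪ Fin d) (n : ℕ) :
    ∃ x, IsAdvOptimal g i n x :=
  exists_forall_le_of_continuous (F := fun y => ∑ t ∈ Finset.Icc 1 n, liftReward i (g t) y)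
    (continuous_finsetSum _ fun t _ => continuous_liftReward i ((hg.holder t).continuous hα hδ))

theorem IsAdversarialModel.epoch_le (hα : 0 < α) (hL : 0 ≤ L) (hg : IsAdversarialModel α L δ g)
    (hA : ∃ a, Function.Injective fun j => A a (i j)) {c R : ℝ} (hc : 4 ≤ c) (hR : 0 ≤ R)
    (x : Cube d) {j τ : ℕ} (hτ : τ ≤ 2 ^ j) (hM : √k / gridSize α d k (2 ^ j) ≤ δ) :
    ∑ s ∈ Finset.range τ, (liftReward i (g (2 ^ j + s)) x -
        roundReward (cab exp3 α A) (fun s => liftReward i (g s)) (2 ^ j + s)) ≤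
      epochBound α L c R d k (2 ^ j) := by
  have hj : 1 ≤ 2 ^ j := Nat.one_le_two_pow
  have hM0 := gridSize_pos α d k (2 ^ j)
  obtain ⟨y, hy, hyx⟩ := exists_mem_strategySet_le hα hL hM0 hA hM x
  set P := strategySet A (gridSize α d k (2 ^ j)) with hP
  have hE0 : 0 ≤ L * (√k / gridSize α d k (2 ^ j)) ^ α := by positivity
  set E := L * (√k / gridSize α d k (2 ^ j)) ^ α with hE
  have hreg := exp3_regret_le (P := P) (r := fun u => liftReward i (g (2 ^ j - 1 + u)))
    (fun t x => hg.mem_Icc _ _) hy hτ hj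
  have hτ' : (τ : ℝ) ≤ ((2 ^ j : ℕ) : ℝ) := by exact_mod_cast hτ
  refine le_trans ?_ (add_sqrt_le_epochBound (L := L) hc hR (Finset.card_pos.2 ⟨y, hy⟩)
    (card_strategySet_le_armBound A))
  calc _ ≤ ∑ s ∈ Finset.range τ, (E + (liftReward i (g (2 ^ j - 1 + (s + 1))) y -
        roundReward (exp3 P (2 ^ j)) (fun u => liftReward i (g (2 ^ j - 1 + u))) (s + 1))) := by
        refine Finset.sum_le_sum fun s hs => ?_
        rw [roundReward_cab _ _ _ _ ((Finset.mem_range.1 hs).trans_le hτ), ← hP,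
          show 2 ^ j - 1 + (s + 1) = 2 ^ j + s by omega]
        linarith [hyx _ (hg.holder (2 ^ j + s))]
    _ = τ * E + ∑ s ∈ Finset.range τ, (liftReward i (g (2 ^ j - 1 + (s + 1))) y -
        roundReward (exp3 P (2 ^ j)) (fun u => liftReward i (g (2 ^ j - 1 + u))) (s + 1)) := by
        rw [Finset.sum_add_distrib, Finset.sum_const, Finset.card_range, nsmul_eq_mul]
    _ ≤ _ := add_le_add (by gcongr) hreg

theorem IsAdversarialModel.sub_roundReward_le (hg : IsAdversarialModel α L δ g) (x : Cube d)
    (π : Policy (Cube d)) (t : ℕ) :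
    liftReward i (g t) x - roundReward π (fun s => liftReward i (g s)) t ≤ 1 := by
  have h1 := (hg.mem_Icc t fun j => x (i j)).2
  have h2 := roundReward_nonneg (π := π) (r := fun s => liftReward i (g s))
    (fun t x => (hg.mem_Icc t _).1) t
  have h3 : liftReward i (g t) x = g t fun j => x (i j) := rfl
  linarith

end adversarial

theorem roundReward_cab_ucb1 {α ζ s₀ : ℝ} {d k : ℕ} {i : Fin k ↪ Fin d} {A : PartitionFamily d k}
    {Ω : Type*} {G : ℕ → Ω → Cube k → ℝ} (pick : Finset (Cube d) → Cube d) (ω : Ω) {j s : ℕ}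
    (hs : s < 2 ^ j) :
    roundReward (cab (ucb1 pick ζ s₀) α A) (fun s => liftReward i (G s ω)) (2 ^ j + s) =
      liftReward i (G (2 ^ j - 1 + (s + 1)) ω)
        (detPlay (ucbRule pick ζ s₀ (strategySet A (gridSize α d k (2 ^ j))))
          (fun u => liftReward i (G (2 ^ j - 1 + u) ω)) s) := by
  rw [roundReward_cab _ _ _ _ hs, ucb1_eq, roundReward_pure]

section stochastic

variable {α L δ ζ s₀ : ℝ} {Ω : Type*} [mΩ : MeasurableSpace Ω] {μ : Measure Ω}
  {d k : ℕ} {G : ℕ → Ω → Cube k → ℝ}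

namespace IsStochasticModel

theorem integrable_apply (hG : IsStochasticModel α L δ ζ s₀ μ G) (t : ℕ) (u : Cube k) :
    Integrable (fun ω => G (t + 1) ω u) μ :=
  ((hG.identDistrib t).comp (measurable_pi_apply u)).integrable_iff.2 (hG.integrable u)

theorem integral_apply (hG : IsStochasticModel α L δ ζ s₀ μ G) (t : ℕ) (u : Cube k) :
    ∫ ω, G (t + 1) ω u ∂μ = meanReward μ G u :=
  ((hG.identDistrib t).comp (measurable_pi_apply u)).integral_eq

theorem exists_optimal (hα : 0 < α) (hδ : 0 < δ) (hG : IsStochasticModel α L δ ζ s₀ μ G)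
    (i : Fin k ↪ Fin d) : ∃ x, IsStochOptimal μ G i x :=
  exists_forall_le_of_continuous (continuous_liftReward i (hG.holder.continuous hα hδ))

/-- The rewards of an epoch, as a finite-armed bandit. -/
theorem isSubGaussianBandit (hG : IsStochasticModel α L δ ζ s₀ μ G) (i : Fin k ↪ Fin d)
    (P : Finset (Cube d)) (a : ℕ) :
    IsSubGaussianBandit μ ζ s₀ P (liftReward i (meanReward μ G))
      (fun t => ⨆ u ∈ Set.Ico a (a + t), MeasurableSpace.comap (G (u + 1)) inferInstance)
      (fun s ω => liftReward i (G (a + s) ω)) where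
  le t := iSup₂_le fun u _ => (hG.measurable u).comap_le
  measurable t s hs x _ := by
    have h1 : Measurable[MeasurableSpace.comap (G (a + s + 1)) inferInstance]
        fun ω => G (a + s + 1) ω fun j => x (i j) :=
      (measurable_pi_apply (fun j => x (i j))).comp (comap_measurable _)
    exact h1.mono (le_iSup₂_of_le (a + s) ⟨by omega, by omega⟩ le_rfl) le_rfl
  indep t x _ := by
    have h := indep_iSup_of_disjoint (fun u => (hG.measurable u).comap_le) hG.indep.iIndep
      (S := Set.Ico a (a + t)) (T := {a + t}) (by simp)
    refine indep_of_indep_of_le_right h (le_trans ?_ (le_iSup₂_of_le (a + t) rfl le_rfl))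
    have h1 : Measurable[MeasurableSpace.comap (G (a + t + 1)) inferInstance]
        fun ω => G (a + t + 1) ω fun j => x (i j) :=
      (measurable_pi_apply (fun j => x (i j))).comp (comap_measurable _)
    exact h1.comap_le
  integrable t x _ := hG.integrable_apply (a + t) _
  integral_eq t x _ := hG.integral_apply (a + t) _
  lintegral_exp_le t x _ s hs := by
    set u : Cube k := fun j => x (i j)
    have happly : Measurable fun f : Cube k → ℝ => f u := measurable_pi_apply u
    have hmeas : Measurable fun f : Cube k → ℝ =>
        ENNReal.ofReal (Real.exp (s * (f u - meanReward μ G u))) :=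
      (Real.measurable_exp.comp ((happly.sub_const _).const_mul s)).ennreal_ofReal
    calc _ = ∫⁻ ω, ENNReal.ofReal (Real.exp (s * (G 1 ω u - meanReward μ G u))) ∂μ :=
          ((hG.identDistrib (a + t)).comp hmeas).lintegral_eq
      _ = ENNReal.ofReal (∫ ω, Real.exp (s * (G 1 ω u - meanReward μ G u)) ∂μ) :=
          (ofReal_integral_eq_lintegral_ofReal (hG.exp_integrable s hs u)
            (.of_forall fun _ => (Real.exp_pos _).le)).symm
      _ ≤ _ := ENNReal.ofReal_le_ofReal (hG.subGaussian s hs u)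

variable {i : Fin k ↪ Fin d} {A : PartitionFamily d k} {pick : Finset (Cube d) → Cube d}

theorem integrable_roundReward (hG : IsStochasticModel α L δ ζ s₀ μ G) (hd : 2 ≤ d) (hk : 1 ≤ k)
    (hpick : ∀ S, S.Nonempty → pick S ∈ S) {t : ℕ} (ht : 1 ≤ t) :
    Integrable (fun ω => roundReward (cab (ucb1 pick ζ s₀) α A)
      (fun s => liftReward i (G s ω)) t) μ := by
  obtain ⟨s, hs⟩ := Nat.exists_eq_add_of_le (Nat.pow_log_le_self 2 (by omega : t ≠ 0))
  have hlt := Nat.lt_pow_succ_log_self one_lt_two t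
  set j := Nat.log 2 t
  have hsj : s < 2 ^ j := by rw [pow_succ] at hlt; omega
  rw [hs]
  simp_rw [roundReward_cab_ucb1 pick _ hsj]
  have hY := hG.isSubGaussianBandit i (strategySet A (gridSize α d k (2 ^ j))) (2 ^ j - 1)
  exact hY.integrable_play hpick
    (strategySet_nonempty A (familySize_pos hd hk) (gridSize_pos α d k (2 ^ j)))
    (F := fun ω => liftReward i (G (2 ^ j - 1 + (s + 1)) ω)) (fun x hx => hY.integrable s x hx) s

/-- The regret of one round, in terms of the mean reward. -/
theorem integral_sub_roundReward [IsProbabilityMeasure μ]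
    (hG : IsStochasticModel α L δ ζ s₀ μ G) (hd : 2 ≤ d) (hk : 1 ≤ k)
    (hpick : ∀ S, S.Nonempty → pick S ∈ S) (x : Cube d) {j s : ℕ} (hs : s < 2 ^ j) :
    ∫ ω, (liftReward i (G (2 ^ j + s) ω) x - roundReward (cab (ucb1 pick ζ s₀) α A)
      (fun s => liftReward i (G s ω)) (2 ^ j + s)) ∂μ =
      liftReward i (meanReward μ G) x - ∫ ω, liftReward i (meanReward μ G)
        (detPlay (ucbRule pick ζ s₀ (strategySet A (gridSize α d k (2 ^ j))))
          (fun u => liftReward i (G (2 ^ j - 1 + u) ω)) s) ∂μ := by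
  have hj : 1 ≤ 2 ^ j := Nat.one_le_two_pow
  have hY := hG.isSubGaussianBandit i (strategySet A (gridSize α d k (2 ^ j))) (2 ^ j - 1)
  have hidx : 2 ^ j + s = 2 ^ j - 1 + s + 1 := by omega
  have hint : Integrable (fun ω => liftReward i (G (2 ^ j + s) ω) x) μ := by
    rw [hidx]
    exact hG.integrable_apply _ _
  rw [integral_sub hint (hG.integrable_roundReward hd hk hpick (by omega))]
  congr 1
  · rw [hidx]
    exact hG.integral_apply _ _
  · simp_rw [roundReward_cab_ucb1 pick _ hs]
    exact hY.integral_reward hpick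
      (strategySet_nonempty A (familySize_pos hd hk) (gridSize_pos α d k (2 ^ j))) s

theorem mean_sub_le (hα : 0 < α) (hL : 0 ≤ L) (hδ : 0 < δ)
    (hG : IsStochasticModel α L δ ζ s₀ μ G) (x y : Cube d) :
    liftReward i (meanReward μ G) x - liftReward i (meanReward μ G) y ≤ rangeBound α L δ k := by
  have := (le_abs_self _).trans (hG.holder.abs_sub_le hα hL hδ (fun j => x (i j)) fun j => y (i j))
  unfold liftReward rangeBound
  linarith

theorem round_le [IsProbabilityMeasure μ]
    (hα : 0 < α) (hL : 0 ≤ L) (hδ : 0 < δ) (hG : IsStochasticModel α L δ ζ s₀ μ G)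
    (hd : 2 ≤ d) (hk : 1 ≤ k) (hpick : ∀ S, S.Nonempty → pick S ∈ S) (x : Cube d) {t : ℕ}
    (ht : 1 ≤ t) :
    ∫ ω, (liftReward i (G t ω) x - roundReward (cab (ucb1 pick ζ s₀) α A)
      (fun s => liftReward i (G s ω)) t) ∂μ ≤ rangeBound α L δ k := by
  obtain ⟨s, hs⟩ := Nat.exists_eq_add_of_le (Nat.pow_log_le_self 2 (by omega : t ≠ 0))
  have hlt := Nat.lt_pow_succ_log_self one_lt_two t
  set j := Nat.log 2 t
  have hsj : s < 2 ^ j := by rw [pow_succ] at hlt; omega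
  rw [hs, hG.integral_sub_roundReward hd hk hpick x hsj, sub_le_comm]
  have hY := hG.isSubGaussianBandit i (strategySet A (gridSize α d k (2 ^ j))) (2 ^ j - 1)
  have hint := hY.integrable_play hpick
    (strategySet_nonempty A (familySize_pos hd hk) (gridSize_pos α d k (2 ^ j)))
    (F := fun _ => liftReward i (meanReward μ G)) (fun x _ => integrable_const _) s
  calc _ = ∫ _, (liftReward i (meanReward μ G) x - rangeBound α L δ k) ∂μ := by simp
    _ ≤ _ := integral_mono (integrable_const _) hint fun ω => by
        have := hG.mean_sub_le (i := i) hα hL hδ x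
          (detPlay (ucbRule pick ζ s₀ (strategySet A (gridSize α d k (2 ^ j))))
            (fun u => liftReward i (G (2 ^ j - 1 + u) ω)) s)
        simp only
        linarith

theorem epoch_le [IsProbabilityMeasure μ]
    (hα : 0 < α) (hL : 0 ≤ L) (hδ : 0 < δ) (hζ : 0 < ζ) (hs₀ : 0 < s₀)
    (hG : IsStochasticModel α L δ ζ s₀ μ G) (hd : 2 ≤ d) (hk : 1 ≤ k)
    (hA : ∃ a, Function.Injective fun j => A a (i j)) {c : ℝ} (hc : 8 * ζ + 32 / s₀ + 5 ≤ c)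
    (hpick : ∀ S, S.Nonempty → pick S ∈ S) (x : Cube d) {j τ : ℕ} (hτ : τ ≤ 2 ^ j)
    (hM : √k / gridSize α d k (2 ^ j) ≤ δ) :
    ∑ s ∈ Finset.range τ, ∫ ω, (liftReward i (G (2 ^ j + s) ω) x -
        roundReward (cab (ucb1 pick ζ s₀) α A) (fun s => liftReward i (G s ω)) (2 ^ j + s)) ∂μ ≤
      epochBound α L c (rangeBound α L δ k) d k (2 ^ j) := by
  have hM0 := gridSize_pos α d k (2 ^ j)
  obtain ⟨y, hy, hyx⟩ := exists_mem_strategySet_le hα hL hM0 hA hM x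
  have hyx := hyx _ hG.holder
  have hY := hG.isSubGaussianBandit i (strategySet A (gridSize α d k (2 ^ j))) (2 ^ j - 1)
  have hR1 := one_le_rangeBound (α := α) hL hδ k
  have hreg := hY.ucb_regret_le hpick hζ hs₀ hy (zero_le_one.trans hR1)
    (fun z _ => hG.mean_sub_le hα hL hδ y z) hτ
  have hE0 : 0 ≤ L * (√k / gridSize α d k (2 ^ j)) ^ α := by positivity
  have hτ' : (τ : ℝ) ≤ ((2 ^ j : ℕ) : ℝ) := by exact_mod_cast hτ
  refine le_trans ?_ (add_ucb_le_epochBound (L := L) hζ.le hs₀ hc hR1 (Finset.card_pos.2 ⟨y, hy⟩)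
    (card_strategySet_le_armBound A))
  set E := L * (√k / gridSize α d k (2 ^ j)) ^ α with hE
  rw [Finset.sum_congr rfl fun s hs => hG.integral_sub_roundReward hd hk hpick x
    ((Finset.mem_range.1 hs).trans_le hτ)]
  calc _ ≤ ∑ s ∈ Finset.range τ, (E + (liftReward i (meanReward μ G) y -
        ∫ ω, liftReward i (meanReward μ G)
          (detPlay (ucbRule pick ζ s₀ (strategySet A (gridSize α d k (2 ^ j))))
            (fun u => liftReward i (G (2 ^ j - 1 + u) ω)) s) ∂μ)) :=
        Finset.sum_le_sum fun s _ => by linarith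
    _ = τ * E + ∑ s ∈ Finset.range τ, (liftReward i (meanReward μ G) y -
        ∫ ω, liftReward i (meanReward μ G)
          (detPlay (ucbRule pick ζ s₀ (strategySet A (gridSize α d k (2 ^ j))))
            (fun u => liftReward i (G (2 ^ j - 1 + u) ω)) s) ∂μ) := by
        rw [Finset.sum_add_distrib, Finset.sum_const, Finset.card_range, nsmul_eq_mul]
    _ ≤ _ := add_le_add (by gcongr) hreg

end IsStochasticModel

end stochastic

end ContinuumBandit

theorem theorem1 (α L δ ζ s₀ : ℝ) (hα : 0 < α) (hα1 : α ≤ 1) (hL : 0 ≤ L) (hδ : 0 < δ)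
    (hζ : 0 < ζ) (hs₀ : 0 < s₀) :
    ∃ C : ℝ, 0 < C ∧ ∀ k : ℕ, 1 ≤ k → ∃ C' N : ℝ, 0 < C' ∧ 0 < N ∧
      ∀ d : ℕ, 2 ≤ d → k ≤ d →
        ENNReal.ofReal (1 - ((d : ℝ) ^ k)⁻¹) ≤
          uniformOn (Set.univ : Set (PartitionFamily d k))
            {A : PartitionFamily d k |
              ∀ i : Fin k ↪ Fin d,
                (∀ (Ω : Type*) (_ : MeasurableSpace Ω) (μ : Measure Ω) (_ : IsProbabilityMeasure μ)
                    (G : ℕ → Ω → Cube k → ℝ), IsStochasticModel α L δ ζ s₀ μ G →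
                  ∀ pick : Finset (Cube d) → Cube d, (∀ S, S.Nonempty → pick S ∈ S) →
                    (∀ t, 1 ≤ t → Integrable (fun ω => roundReward (cab (ucb1 pick ζ s₀) α A)
                      (fun s => liftReward i (G s ω)) t) μ) ∧
                    (∃ x, IsStochOptimal μ G i x) ∧
                    ∀ x, IsStochOptimal μ G i x → ∀ n : ℕ, 2 ≤ n →
                      RegretBound C C' N α d k n
                        (stochRegret μ G i (cab (ucb1 pick ζ s₀) α A) x n)) ∧
                (∀ g : ℕ → Cube k → ℝ, IsAdversarialModel α L δ g →
                  ∀ n : ℕ, 2 ≤ n →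
                    (∃ x, IsAdvOptimal g i n x) ∧
                    ∀ x, IsAdvOptimal g i n x →
                      RegretBound C C' N α d k n (advRegret g i (cab exp3 α A) x n))} := by
  have hc4 : 4 ≤ 8 * ζ + 32 / s₀ + 5 := by
    have : 0 ≤ 32 / s₀ := by positivity
    linarith
  obtain ⟨C, hC, hCk⟩ := exists_regretBound_of_epochBound hα hα1 hL
    (c := 8 * ζ + 32 / s₀ + 5) (by linarith)
  refine ⟨C, hC, fun k hk => ?_⟩
  have hR1 := one_le_rangeBound (α := α) hL hδ k
  obtain ⟨C', N, hC', hN, hbound⟩ := hCk k hk _ δ hR1 hδ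
  refine ⟨C', N, hC', hN, fun d hd _ => (le_uniformOn_isSeparating hd hk).trans
    (measure_mono fun A hA i => ⟨?_, ?_⟩)⟩
  · intro Ω _ μ _ G hG pick hpick
    exact ⟨fun t ht => hG.integrable_roundReward hd hk hpick ht, hG.exists_optimal hα hδ i,
      fun x _ n hn => hbound d hd _ (fun t ht => hG.round_le hα hL hδ hd hk hpick x ht)
        (fun j τ hτ hM => hG.epoch_le hα hL hδ hζ hs₀ hd hk (hA i) le_rfl hpick x hτ hM) n hn⟩
  · intro g hg n hn
    exact ⟨hg.exists_optimal hα hδ i n, fun x _ => hbound d hd _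
      (fun t _ => (hg.sub_roundReward_le x _ t).trans hR1)
      (fun j τ hτ hM => hg.epoch_le hα hL (hA i) hc4 (zero_le_one.trans hR1) x hτ hM) n hn⟩
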